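/- Let $\lambda\in(0,1)$ and $t\in\mathbb R$ satisfy $\lambda^t=\tfrac12$. Put $W_n=(\lambda^n,\lambda^{n-1}]$ for $n\ge 1$, and let $F=F_\lambda:(0,1]\to(0,1]$ be given by $F(x)=\frac{x-\lambda}{1-\lambda}$ on $W_1$ and $F(x)=\frac{x-\lambda^n}{\lambda(1-\lambda)}$ on $W_n$, $n\ge2$. Let $\Phi_t=-t\log|F'|$, with the left-hand derivative at the points $\lambda^n$. Definitions, for a potential $\phi:(0,1]\to\mathbb R$ with ergodic sums $S_n\phi=\sum_{k=0}^{n-1}\phi\circ F^k$: * A Borel probability measure $m$ is $\phi$-conformal if $m(F(A))=\int_A e^{-\phi}\,dm$ for every Borel set $A$ on which $F$ is one-to-one. $P_{\rm Conf}(\phi)$ is the infimum of the $p\in\mathbb R$ for which a $(\phi-p)$-conformal probability measure exists. * A measure $m$ is conservative if it is non-singular ($m(A)=0$ if and only if $m(F^{-1}A)=0$) and $m(S)=0$ for every Borel set $S$ whose preimages $F^{-n}S$, $n\ge0$, are pairwise disjoint. * $Z_n(\phi,W_e)=\sum_{x\in W_e,\ F^nx=x}e^{S_n\phi(x)}$,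 and $Z^*_n(\phi,W_e)$ is the same sum restricted to those $x$ with $F^kx\notin W_e$ for $0<k<n$. The Gurevich pressure is $P_G(\phi)=\lim_n\frac1n\log Z_n(\phi,W_e)$. * $\phi$ is recurrent if $\sum_{n\ge1}e^{-nP_G(\phi)}Z_n(\phi,W_e)=\infty$; it is positive recurrent if moreover $\sum_{n\ge1}ne^{-nP_G(\phi)}Z^*_n(\phi,W_e)<\infty$, and null recurrent if it is recurrent but not positive recurrent. * $(L_\phi v)(x)=\sum_{F(y)=x}e^{\phi(y)}v(y)$. Then, with $p:=\log\frac{(1-\lambda)^t}{1-\lambda^t}$: 1. $p=P_{\rm Conf}(\Phi_t)$, the infimum being attained, and $P_G(\Phi_t)$ exists and equals $p$, whichever $e\ge 1$ is used. 2. $((0,1],F_\lambda,\Phi_t)$ is null recurrent: $\Phi_t$ is null recurrent in the above sense for every choice of $e\ge1$; moreover there is a conservative $(\Phi_t-p)$-conformal probability measure, and there is no $F$-invariant probability measure that is absolutely continuous with respect to a conservative $(\Phi_t-p)$-conformal probability measure. 3. Let $D=(D_{i,j})_{i,j\ge1}$ be the matrix with $D_{1,j}=\frac12$ for all $j$, and,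 for $i\ge2$, $D_{i,j}=\frac14$ if $j\ge i-1$ and $D_{i,j}=0$ otherwise. For every $k\ge1$ the first column of $D^k$ is $$(D^k)_{1,1}=\frac{1}{2^{2k-1}}\binom{2k-1}{k-1},\qquad (D^k)_{i,1}=\frac1{2^{2k}}\binom{2k+1-i}{k+1-i}\ (2\le i\le k+1),\qquad (D^k)_{i,1}=0\ (i>k+1),$$ and $Z_k(\Phi_t-p,W_1)=(D^k)_{1,1}=\frac{1}{2^{2k-1}}\binom{2k-1}{k-1}$. 4. There is $C>0$ such that $Z_k(\Phi_t-p,W_1)\ge C/\sqrt k$ for all $k\ge1$. 5. There is exactly one $(\Phi_t-p)$-conformal probability measure $m_t$. There is a positive measurable function $\rho_t$, constant on each $W_i$, with $L_{\Phi_t}\rho_t=e^p\rho_t$ and $\int_{W_i}\rho_t\,dm_t=1$ for all $i\ge1$; and every positive measurable $\rho$ with $L_{\Phi_t}\rho=e^p\rho$ satisfies $\int\rho\,dm_t=\infty$. -/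

import Mathlib

open MeasureTheory Filter Topology Set
open scoped ENNReal

noncomputable section

namespace ConformalMarkov

/-! ### General notions for a dynamical system `f : X → X` with a potential `φ : X → ℝ` -/

/-- `m` is `φ`-conformal: `m (f A) = ∫_A e^{-φ} dm` for every measurable `A` on which `f` is
one-to-one. -/
def IsConformal {X : Type*} [MeasurableSpace X] (f : X → X) (φ : X → ℝ) (m : Measure X) : Prop :=
  ∀ A : Set X, MeasurableSet A → InjOn f A →
    m (f '' A) = ∫⁻ x in A, ENNReal.ofReal (Real.exp (-φ x)) ∂m

/-- The set of `p` for which there is a `(φ - p)`-conformal probability measure. Its infimum is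
the conformal pressure of `φ`. -/
def conformalParameters {X : Type*} [MeasurableSpace X] (f : X → X) (φ : X → ℝ) : Set ℝ :=
  {p | ∃ m : Measure X, IsProbabilityMeasure m ∧ IsConformal f (fun x => φ x - p) m}

/-- The conformal pressure. -/
def conformalPressure {X : Type*} [MeasurableSpace X] (f : X → X) (φ : X → ℝ) : ℝ :=
  sInf (conformalParameters f φ)

/-- `μ A = 0` if and only if `μ (f⁻¹ A) = 0`. -/
def IsNonsingular {X : Type*} [MeasurableSpace X] (f : X → X) (μ : Measure X) : Prop :=
  ∀ A : Set X, MeasurableSet A → (μ A = 0 ↔ μ (f ⁻¹' A) = 0)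

/-- The sets `f⁻ⁿ S`, `n ≥ 0`, are pairwise disjoint. -/
def IsWandering {X : Type*} (f : X → X) (S : Set X) : Prop :=
  Pairwise fun i j : ℕ => Disjoint (f^[i] ⁻¹' S) (f^[j] ⁻¹' S)

/-- A nonsingular measure for which every (measurable) wandering set is null. -/
def IsConservative {X : Type*} [MeasurableSpace X] (f : X → X) (μ : Measure X) : Prop :=
  IsNonsingular f μ ∧ ∀ S : Set X, MeasurableSet S → IsWandering f S → μ S = 0

/-- Null recurrence in terms of measures, with respect to the pressure `p`: there is a
conservative `(φ - p)`-conformal probability measure, and no `f`-invariant probability measure is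
absolutely continuous with respect to such a measure. -/
def IsMeasureNullRecurrent {X : Type*} [MeasurableSpace X] (f : X → X) (φ : X → ℝ) (p : ℝ) :
    Prop :=
  (∃ m : Measure X, IsProbabilityMeasure m ∧ IsConformal f (fun x => φ x - p) m ∧
      IsConservative f m) ∧
  ∀ m : Measure X, IsProbabilityMeasure m → IsConformal f (fun x => φ x - p) m →
    IsConservative f m →
      ¬ ∃ μ : Measure X, IsProbabilityMeasure μ ∧ MeasurePreserving f μ μ ∧ μ ≪ m

/-- The local partition function `Z_n(φ, A) = ∑_{x ∈ A, fⁿ x = x} e^{S_n φ(x)}` (for `n ≥ 1`). -/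
def localPartition {X : Type*} (f : X → X) (φ : X → ℝ) (n : ℕ) (A : Set X) : ℝ≥0∞ :=
  ∑' x : {x : X // x ∈ A ∧ f^[n] x = x}, ENNReal.ofReal (Real.exp (birkhoffSum f φ n x))

/-- The first-return local partition function `Z*_n(φ, A)`: only those periodic points count
whose orbit avoids `A` at the times `0 < k < n`. -/
def firstReturnPartition {X : Type*} (f : X → X) (φ : X → ℝ) (n : ℕ) (A : Set X) : ℝ≥0∞ :=
  ∑' x : {x : X // x ∈ A ∧ f^[n] x = x ∧ ∀ k, 0 < k → k < n → f^[k] x ∉ A},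
    ENNReal.ofReal (Real.exp (birkhoffSum f φ n x))

/-- `P` is the Gurevich pressure computed at `A`: `P = lim (1/n) log Z_n(φ, A)`. -/
def IsGurevichPressure {X : Type*} (f : X → X) (φ : X → ℝ) (A : Set X) (P : ℝ) : Prop :=
  Tendsto (fun n : ℕ => ENNReal.log (localPartition f φ n A) / (n : EReal)) atTop
    (𝓝 (P : EReal))

/-- `φ` is recurrent (computed at the 1-cylinder `A`): `∑_{n ≥ 1} e^{-nP_G} Z_n(φ, A) = ∞`. -/
def IsRecurrent {X : Type*} (f : X → X) (φ : X → ℝ) (A : Set X) : Prop :=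
  ∃ P : ℝ, IsGurevichPressure f φ A P ∧
    ∑' n : ℕ, ENNReal.ofReal (Real.exp (-((n : ℝ) + 1) * P)) * localPartition f φ (n + 1) A = ∞

/-- `φ` is positive recurrent (computed at the 1-cylinder `A`): it is recurrent and
`∑_{n ≥ 1} n e^{-nP_G} Z*_n(φ, A) < ∞`. -/
def IsPositiveRecurrent {X : Type*} (f : X → X) (φ : X → ℝ) (A : Set X) : Prop :=
  IsRecurrent f φ A ∧ ∃ P : ℝ, IsGurevichPressure f φ A P ∧
    ∑' n : ℕ, ((n : ℝ≥0∞) + 1) * ENNReal.ofReal (Real.exp (-((n : ℝ) + 1) * P)) *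
      firstReturnPartition f φ (n + 1) A < ∞

/-- Recurrent but not positive recurrent (computed at the 1-cylinder `A`). -/
def IsNullRecurrent {X : Type*} (f : X → X) (φ : X → ℝ) (A : Set X) : Prop :=
  IsRecurrent f φ A ∧ ¬ IsPositiveRecurrent f φ A

/-- `ρ` is a positive measurable eigenfunction, with eigenvalue `s`, of the transfer operator
`(L_φ v)(x) = ∑_{f y = x} e^{φ(y)} v(y)`. -/
def IsPositiveEigenfunction {X : Type*} [MeasurableSpace X] (f : X → X) (φ : X → ℝ) (s : ℝ)
    (ρ : X → ℝ) : Prop :=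
  Measurable ρ ∧ (∀ x, 0 < ρ x) ∧
    ∀ x, ∑' y : {y : X // f y = x}, ENNReal.ofReal (Real.exp (φ y) * ρ y) =
      ENNReal.ofReal (s * ρ x)

/-- Powers of a nonnegative matrix with an arbitrary index set. -/
def matPow {ι : Type*} [DecidableEq ι] (M : ι → ι → ℝ≥0∞) : ℕ → ι → ι → ℝ≥0∞
  | 0 => fun i j => if i = j then 1 else 0
  | k + 1 => fun i j => ∑' r, M i r * matPow M k r j

/-! ### The map `F_λ` on `(0,1]` -/

/-- The interval `W_n = (λⁿ, λⁿ⁻¹]`, `n ≥ 1`, as a subset of `(0,1]`. -/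
def W (l : ℝ) (n : ℕ+) : Set (Ioc (0 : ℝ) 1) :=
  {x | l ^ (n : ℕ) < (x : ℝ) ∧ (x : ℝ) ≤ l ^ ((n : ℕ) - 1)}

/-- The least `n` with `λⁿ < x`; for `x ∈ (0,1]` this is the `n` with `x ∈ W_n`. -/
def branchIndex (l x : ℝ) : ℕ := sInf {n : ℕ | l ^ n < x}

/-- The formula for `F_λ`, as a function of a real variable (only `x ∈ (0,1]` matters). -/
def branchMap (l x : ℝ) : ℝ :=
  if branchIndex l x = 1 then (x - l) / (1 - l)
  else (x - l ^ branchIndex l x) / (l * (1 - l))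

theorem branchIndex_spec {l : ℝ} (hl : l ∈ Ioo (0 : ℝ) 1) {x : ℝ} (hx : x ∈ Ioc (0 : ℝ) 1) :
    1 ≤ branchIndex l x ∧ l ^ branchIndex l x < x ∧ x ≤ l ^ (branchIndex l x - 1) := by
  have hne : {n : ℕ | l ^ n < x}.Nonempty := exists_pow_lt_of_lt_one hx.1 hl.2
  have h1 : l ^ branchIndex l x < x := Nat.sInf_mem hne
  have h0 : 1 ≤ branchIndex l x := by
    rcases Nat.eq_zero_or_pos (branchIndex l x) with h | h
    · rw [h, pow_zero] at h1
      exact absurd hx.2 (not_le.mpr h1)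
    · exact h
  refine ⟨h0, h1, ?_⟩
  by_contra hc
  have hm : branchIndex l x - 1 ∈ {n : ℕ | l ^ n < x} := not_le.mp hc
  have h2 : branchIndex l x ≤ branchIndex l x - 1 := Nat.sInf_le hm
  omega

theorem mem_W_iff {l : ℝ} (hl : l ∈ Ioo (0 : ℝ) 1) (n : ℕ+) (x : Ioc (0 : ℝ) 1) :
    x ∈ W l n ↔ branchIndex l x = n := by
  obtain ⟨h0, h1, h2⟩ := branchIndex_spec hl x.2
  constructor
  · rintro ⟨h3, h4⟩
    refine le_antisymm (Nat.sInf_le h3) ?_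
    by_contra hc
    have hn : branchIndex l x ≤ (n : ℕ) - 1 := by omega
    have := pow_le_pow_of_le_one hl.1.le hl.2.le hn
    linarith
  · intro h
    rw [h] at h1 h2
    exact ⟨h1, h2⟩

theorem branchMap_mem {l : ℝ} (hl : l ∈ Ioo (0 : ℝ) 1) {x : ℝ} (hx : x ∈ Ioc (0 : ℝ) 1) :
    branchMap l x ∈ Ioc (0 : ℝ) 1 := by
  obtain ⟨h0, h1, h2⟩ := branchIndex_spec hl hx
  have hl0 : 0 < l := hl.1
  have hl1 : 0 < 1 - l := sub_pos.mpr hl.2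
  unfold branchMap
  split_ifs with h
  · rw [h, pow_one] at h1
    exact ⟨div_pos (by linarith) hl1, by rw [div_le_one hl1]; linarith [hx.2]⟩
  · obtain ⟨k, hk⟩ : ∃ k, branchIndex l x = k + 2 := ⟨branchIndex l x - 2, by omega⟩
    rw [hk] at h1 h2 ⊢
    have h3 : k + 2 - 1 = k + 1 := rfl
    rw [h3] at h2
    have hp : l ^ k ≤ 1 := pow_le_one₀ hl0.le hl.2.le
    refine ⟨div_pos (by linarith) (mul_pos hl0 hl1), ?_⟩
    rw [div_le_one (mul_pos hl0 hl1)]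
    have h4 : x - l ^ (k + 2) ≤ l ^ k * (l * (1 - l)) := by
      have : l ^ k * (l * (1 - l)) = l ^ (k + 1) - l ^ (k + 2) := by ring
      linarith
    have h5 : l ^ k * (l * (1 - l)) ≤ 1 * (l * (1 - l)) :=
      mul_le_mul_of_nonneg_right hp (mul_pos hl0 hl1).le
    linarith

/-- The map `F_λ : (0,1] → (0,1]`. -/
def F {l : ℝ} (hl : l ∈ Ioo (0 : ℝ) 1) (x : Ioc (0 : ℝ) 1) : Ioc (0 : ℝ) 1 :=
  ⟨branchMap l x, branchMap_mem hl x.2⟩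

/-- The geometric potential `Φ_t = -t log |F_λ'|`. The derivative is the left-hand one: every
`W_n` contains its right endpoint, so this is the slope of the branch that is used at `x`. -/
def geomPotential (l t : ℝ) (x : Ioc (0 : ℝ) 1) : ℝ :=
  -t * Real.log |derivWithin (branchMap l) (Iic (x : ℝ)) (x : ℝ)|

/-- The infinite matrix whose first row is constantly `1/2`, and whose `i`-th row, `i ≥ 2`, has
the entries `1/4` in the columns `j ≥ i - 1` and `0` elsewhere. -/
def nullMatrix (i j : ℕ+) : ℝ≥0∞ :=
  if i = 1 then 1 / 2 else if (i : ℕ) ≤ (j : ℕ) + 1 then 1 / 4 else 0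

end ConformalMarkov

end

/-!
Since `λᵗ = 1/2`, the normalised potential `Φ_t - p` takes only two values: `e^{Φ_t - p}` is `1/2`
on `W_1` and `1/4` on every other `W_n` (`ofReal_exp_geomPotential_sub`). As `F` maps `W_n` affinely
onto the union of the `W_j` with `j ≥ n - 1`, everything is governed by the matrix `D = nullMatrix`.

*Partition functions.* Around each admissible loop in the transition graph the composition of the
inverse branches is an affine contraction of `W_e` into itself, with exactly one fixed point; hence
the sums over periodic points, with or without a condition on the intermediate positions, are sums
over paths (`tsum_iterate_eq_affine`, `tsum_periodic`), and `Z_k(Φ_t - p, W_e) = (Dᵏ)_{ee}`. The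
hockey-stick identity gives the first column of `Dᵏ` (`matPow_nullMatrix_col`); in particular
`(Dᵏ)₁₁ = C(2k,k) / 4ᵏ`, which is of order `1/√k`. Since `D` is irreducible, every `(Dᵏ)_{ee}` is
comparable to it: it tends to zero, but only polynomially and with a divergent sum. This yields the
Gurevich pressure and recurrence. A renewal argument excludes positive recurrence: with a finite
mean return time the renewal sequence `(Dᵏ)_{ee}` could not tend to zero
(`tsum_mul_eq_top_of_renewal`).

*Conformal measures.* The numbers `T_n = m((0, λⁿ])` of a `(Φ_t - q)`-conformal probability satisfy
`T_{n+2} = T_{n+1} - (c/4) T_n` with `c = e^{p-q}`. If `q < p` the characteristic roots are not real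
and the solutions cannot stay nonnegative (`false_of_recursion`); if `q = p` then `T_n = 2⁻ⁿ`, and
the self-similarity of the distribution function determines the measure
(`IsBranchConformal.unique`). For `λ = 1/2` Lebesgue measure is conformal, and the conjugacy that
matches itineraries transports it to every `λ` (`isBranchConformal_map_code`).

*Null recurrence.* From `m(W_i ∩ F⁻ᵏ A) = ∑_j (Dᵏ)_{ij} m(W_j ∩ A)` follow conservativity, because
`∑_k (Dᵏ)_{1j} = ∞`, and `m(F⁻ᵏ W_j) → 0`, because `(Dᵏ)_{1j} → 0`. The latter passes to every
finite measure `μ ≪ m` and contradicts the invariance of `μ`. The function `2ⁿ` on `W_n` is an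
eigenfunction, and an integrable positive eigenfunction would be the density of an invariant
probability measure.
-/

noncomputable section

namespace ConformalMarkov

/-! ### The branches of the map and their inverses -/

/-- The index `n` of the interval `W_n` that contains `x`. -/
def idx {l : ℝ} (hl : l ∈ Ioo (0 : ℝ) 1) (x : Ioc (0 : ℝ) 1) : ℕ+ :=
  ⟨branchIndex l x, (branchIndex_spec hl x.2).1⟩

/-- The contraction ratio of the inverse of the `n`-th branch. -/
def ratio (l : ℝ) (n : ℕ+) : ℝ := if n = 1 then 1 - l else l * (1 - l)

theorem mem_W_iff_idx {l : ℝ} (hl : l ∈ Ioo (0 : ℝ) 1) (n : ℕ+) (x : Ioc (0 : ℝ) 1) :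
    x ∈ W l n ↔ idx hl x = n := by
  rw [mem_W_iff hl, ← PNat.coe_inj]; rfl

theorem idx_lower {l : ℝ} (hl : l ∈ Ioo (0 : ℝ) 1) (x : Ioc (0 : ℝ) 1) :
    l ^ (idx hl x : ℕ) < x := (branchIndex_spec hl x.2).2.1

theorem idx_upper {l : ℝ} (hl : l ∈ Ioo (0 : ℝ) 1) (x : Ioc (0 : ℝ) 1) :
    (x : ℝ) ≤ l ^ ((idx hl x : ℕ) - 1) := (branchIndex_spec hl x.2).2.2

theorem ratio_pos {l : ℝ} (hl : l ∈ Ioo (0 : ℝ) 1) (n : ℕ+) : 0 < ratio l n := by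
  have h0 : 0 < l := hl.1
  have h1 : 0 < 1 - l := sub_pos.mpr hl.2
  unfold ratio; split_ifs <;> positivity

theorem ratio_lt_one {l : ℝ} (hl : l ∈ Ioo (0 : ℝ) 1) (n : ℕ+) : ratio l n < 1 := by
  have h0 : 0 < l := hl.1
  have h1 : 0 < 1 - l := sub_pos.mpr hl.2
  unfold ratio; split_ifs <;> nlinarith

/-- The right endpoint `λⁿ⁻²` of the image of the `n`-th branch is sent to the right endpoint of
`W_n`; for `n = 1` the truncated subtraction gives the correct exponent `0`. -/
theorem pow_add_ratio_mul {l : ℝ} (n : ℕ+) :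
    l ^ (n : ℕ) + ratio l n * l ^ ((n : ℕ) - 2) = l ^ ((n : ℕ) - 1) := by
  unfold ratio
  split_ifs with h
  · subst h; simp
  · have h2 : (n : ℕ) ≠ 1 := fun hc => h (PNat.coe_eq_one_iff.mp hc)
    obtain ⟨k, hk⟩ : ∃ k, (n : ℕ) = k + 2 := ⟨(n : ℕ) - 2, by have := n.pos; omega⟩
    rw [hk, show k + 2 - 2 = k by omega, show k + 2 - 1 = k + 1 by omega]
    ring

theorem le_pow_iff {l : ℝ} (hl : l ∈ Ioo (0 : ℝ) 1) (x : Ioc (0 : ℝ) 1) (k : ℕ) :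
    (x : ℝ) ≤ l ^ k ↔ k < idx hl x := by
  constructor
  · intro h
    by_contra hc
    have := pow_le_pow_of_le_one hl.1.le hl.2.le (not_lt.mp hc)
    linarith [idx_lower hl x]
  · intro h
    exact (idx_upper hl x).trans (pow_le_pow_of_le_one hl.1.le hl.2.le (by omega))

theorem le_pow_sub_two_iff {l : ℝ} (hl : l ∈ Ioo (0 : ℝ) 1) (x : Ioc (0 : ℝ) 1) (n : ℕ+) :
    (x : ℝ) ≤ l ^ ((n : ℕ) - 2) ↔ n ≤ idx hl x + 1 := by
  rw [le_pow_iff hl, ← PNat.coe_le_coe, PNat.add_coe]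
  have := n.pos
  have := (idx hl x).pos
  simp only [PNat.one_coe]
  omega

theorem pow_add_ratio_mul_mem {l : ℝ} (hl : l ∈ Ioo (0 : ℝ) 1) (n : ℕ+) {y : ℝ}
    (hy : y ∈ Ioc 0 (l ^ ((n : ℕ) - 2))) :
    l ^ (n : ℕ) + ratio l n * y ∈ Ioc (l ^ (n : ℕ)) (l ^ ((n : ℕ) - 1)) := by
  have hr := ratio_pos hl n
  refine ⟨by have := mul_pos hr hy.1; linarith, ?_⟩
  rw [← pow_add_ratio_mul]
  have := mul_le_mul_of_nonneg_left hy.2 hr.le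
  linarith

/-- The inverse of the `n`-th branch. The affine formula maps all of `(0,1]` into itself; only its
values on the image `(0, λⁿ⁻²]` of the branch have a dynamical meaning. -/
def invBranch {l : ℝ} (hl : l ∈ Ioo (0 : ℝ) 1) (n : ℕ+) (y : Ioc (0 : ℝ) 1) : Ioc (0 : ℝ) 1 :=
  ⟨l ^ (n : ℕ) + ratio l n * y, by
    have h0 : 0 < l := hl.1
    have hr := ratio_pos hl n
    have hy0 := y.2.1
    refine ⟨by positivity, ?_⟩
    have hy : ratio l n * (y : ℝ) ≤ ratio l n := by nlinarith [y.2.2]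
    have h1 : l ^ (n : ℕ) + ratio l n ≤ 1 := by
      unfold ratio
      split_ifs with h
      · subst h; simp
      · have h2 : (n : ℕ) ≠ 1 := fun hc => h (PNat.coe_eq_one_iff.mp hc)
        have : l ^ (n : ℕ) ≤ l ^ 2 :=
          pow_le_pow_of_le_one h0.le hl.2.le (by have := n.pos; omega)
        nlinarith [hl.2]
    linarith⟩

@[simp] theorem coe_invBranch {l : ℝ} (hl : l ∈ Ioo (0 : ℝ) 1) (n : ℕ+) (y : Ioc (0 : ℝ) 1) :
    (invBranch hl n y : ℝ) = l ^ (n : ℕ) + ratio l n * y := rfl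

theorem F_coe {l : ℝ} (hl : l ∈ Ioo (0 : ℝ) 1) (x : Ioc (0 : ℝ) 1) :
    (F hl x : ℝ) = ((x : ℝ) - l ^ (idx hl x : ℕ)) / ratio l (idx hl x) := by
  have h1 : idx hl x = 1 ↔ branchIndex l x = 1 := by rw [← PNat.coe_eq_one_iff]; rfl
  have h2 : (idx hl x : ℕ) = branchIndex l x := rfl
  show branchMap l x = _
  unfold branchMap ratio
  simp only [h1, h2]
  split_ifs with h
  · rw [h, pow_one]
  · rfl

theorem idx_invBranch {l : ℝ} (hl : l ∈ Ioo (0 : ℝ) 1) {n : ℕ+} {y : Ioc (0 : ℝ) 1}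
    (h : n ≤ idx hl y + 1) : idx hl (invBranch hl n y) = n := by
  rw [← le_pow_sub_two_iff] at h
  rw [← mem_W_iff_idx]
  exact pow_add_ratio_mul_mem hl n ⟨y.2.1, h⟩

theorem F_invBranch {l : ℝ} (hl : l ∈ Ioo (0 : ℝ) 1) {n : ℕ+} {y : Ioc (0 : ℝ) 1}
    (h : n ≤ idx hl y + 1) : F hl (invBranch hl n y) = y := by
  apply Subtype.ext
  rw [F_coe, idx_invBranch hl h, coe_invBranch, add_sub_cancel_left,
    mul_div_cancel_left₀ _ (ratio_pos hl n).ne']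

theorem invBranch_F {l : ℝ} (hl : l ∈ Ioo (0 : ℝ) 1) (x : Ioc (0 : ℝ) 1) :
    invBranch hl (idx hl x) (F hl x) = x := by
  apply Subtype.ext
  rw [coe_invBranch, F_coe, mul_div_cancel₀ _ (ratio_pos hl _).ne']
  ring

theorem idx_le_idx_F {l : ℝ} (hl : l ∈ Ioo (0 : ℝ) 1) (x : Ioc (0 : ℝ) 1) :
    idx hl x ≤ idx hl (F hl x) + 1 := by
  rw [← le_pow_sub_two_iff, F_coe, div_le_iff₀ (ratio_pos hl _)]
  have := pow_add_ratio_mul (l := l) (idx hl x)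
  linarith [idx_upper hl x]

theorem measurableSet_W (l : ℝ) (n : ℕ+) : MeasurableSet (W l n) :=
  (measurableSet_lt measurable_const measurable_subtype_coe).inter
    (measurableSet_le measurable_subtype_coe measurable_const)

theorem measurable_comp_idx {l : ℝ} (hl : l ∈ Ioo (0 : ℝ) 1) {β : Type*} [MeasurableSpace β]
    (f : ℕ+ → β) : Measurable fun x => f (idx hl x) := by
  let _ : MeasurableSpace ℕ+ := ⊤
  have h : Measurable (idx hl) := by
    refine measurable_to_countable' fun n => ?_
    have : idx hl ⁻¹' {n} = W l n := by ext x; simp [mem_W_iff_idx hl]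
    rw [this]; exact measurableSet_W l n
  exact (measurable_from_top (f := f)).comp h

theorem measurableSet_idx {l : ℝ} (hl : l ∈ Ioo (0 : ℝ) 1) (P : ℕ+ → Prop) :
    MeasurableSet {x | P (idx hl x)} :=
  measurableSet_setOfPred.mpr (measurable_comp_idx hl P)

theorem measurable_F {l : ℝ} (hl : l ∈ Ioo (0 : ℝ) 1) : Measurable (F hl) := by
  have h : Measurable fun x : Ioc (0 : ℝ) 1 => (F hl x : ℝ) := by
    simp only [F_coe hl]
    exact (measurable_subtype_coe.sub (measurable_comp_idx hl fun n : ℕ+ => l ^ (n : ℕ))).div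
      (measurable_comp_idx hl (ratio l))
  exact h.subtype_mk

theorem measurable_invBranch {l : ℝ} (hl : l ∈ Ioo (0 : ℝ) 1) (n : ℕ+) :
    Measurable (invBranch hl n) :=
  Measurable.subtype_mk ((measurable_subtype_coe.const_mul _).const_add _)

/-! ### The normalised potential -/

/-- The values of `e^{Φ_t - p}`: `1/2` on `W_1` and `1/4` on the other intervals. -/
def weight (n : ℕ+) : ℝ≥0∞ := if n = 1 then 1 / 2 else 1 / 4

/-- The pressure `log ((1-λ)ᵗ / (1-λᵗ))`. -/
def pressure (l t : ℝ) : ℝ := Real.log ((1 - l) ^ t / (1 - l ^ t))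

theorem nullMatrix_eq (i j : ℕ+) : nullMatrix i j = if i ≤ j + 1 then weight i else 0 := by
  have h : i ≤ j + 1 ↔ (i : ℕ) ≤ (j : ℕ) + 1 := by
    rw [← PNat.coe_le_coe, PNat.add_coe, PNat.one_coe]
  unfold nullMatrix weight
  simp only [h]
  by_cases hi : i = 1 <;> simp [hi]

theorem weight_ne_zero (n : ℕ+) : weight n ≠ 0 := by
  unfold weight; split_ifs <;> simp

theorem weight_ne_top (n : ℕ+) : weight n ≠ ∞ := by
  unfold weight; split_ifs <;> simp

theorem geomPotential_eq {l : ℝ} (hl : l ∈ Ioo (0 : ℝ) 1) (t : ℝ) (x : Ioc (0 : ℝ) 1) :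
    geomPotential l t x = t * Real.log (ratio l (idx hl x)) := by
  set n := idx hl x with hn
  have hr := ratio_pos hl n
  have hd : HasDerivWithinAt (fun y : ℝ => (y - l ^ (n : ℕ)) / ratio l n) (1 / ratio l n)
      (Iic (x : ℝ)) x := (((hasDerivAt_id (x : ℝ)).sub_const _).div_const _).hasDerivWithinAt
  have hnhds : branchMap l =ᶠ[𝓝[Iic (x : ℝ)] (x : ℝ)]
      fun y : ℝ => (y - l ^ (n : ℕ)) / ratio l n := by
    have : Ioc (l ^ (n : ℕ)) (x : ℝ) ∈ 𝓝[Iic (x : ℝ)] (x : ℝ) :=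
      Ioc_mem_nhdsLE (idx_lower hl x)
    filter_upwards [this] with y hy
    have hy0 : y ∈ Ioc (0 : ℝ) 1 :=
      ⟨(pow_pos hl.1 _).trans hy.1, hy.2.trans x.2.2⟩
    have hW : idx hl ⟨y, hy0⟩ = n := by
      rw [← mem_W_iff_idx]
      exact ⟨hy.1, hy.2.trans (idx_upper hl x)⟩
    have := F_coe hl ⟨y, hy0⟩
    rw [hW] at this
    exact this
  have hx : branchMap l x = ((x : ℝ) - l ^ (n : ℕ)) / ratio l n := F_coe hl x
  have := (hd.congr_of_eventuallyEq hnhds hx).derivWithin (uniqueDiffWithinAt_Iic _)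
  rw [geomPotential, this, abs_of_pos (by positivity), one_div, Real.log_inv]
  ring

theorem ofReal_exp_geomPotential_sub {l t : ℝ} (hl : l ∈ Ioo (0 : ℝ) 1) (ht : l ^ t = 1 / 2)
    (x : Ioc (0 : ℝ) 1) :
    ENNReal.ofReal (Real.exp (geomPotential l t x - pressure l t)) = weight (idx hl x) := by
  have h0 : 0 < l := hl.1
  have h1 : 0 < 1 - l := sub_pos.mpr hl.2
  have h1t : 0 < (1 - l) ^ t := Real.rpow_pos_of_pos h1 t
  have hp : Real.exp (pressure l t) = (1 - l) ^ t * 2 := by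
    rw [pressure, ht, Real.exp_log (by norm_num; positivity)]
    norm_num
    ring
  rw [Real.exp_sub, hp, geomPotential_eq hl, mul_comm t, ← Real.rpow_def_of_pos (ratio_pos hl _)]
  unfold ratio weight
  split_ifs with h
  · rw [show (1 - l) ^ t / ((1 - l) ^ t * 2) = 1 / 2 by field_simp]
    rw [ENNReal.ofReal_div_of_pos (by norm_num)]; simp
  · rw [Real.mul_rpow h0.le h1.le, ht,
      show 1 / 2 * (1 - l) ^ t / ((1 - l) ^ t * 2) = 1 / 4 by field_simp; norm_num]
    rw [ENNReal.ofReal_div_of_pos (by norm_num)]; simp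

/-! ### Powers of the transition matrix -/

theorem matPow_one {ι : Type*} [DecidableEq ι] (M : ι → ι → ℝ≥0∞) (i j : ι) :
    matPow M 1 i j = M i j := by
  show ∑' r, M i r * (if r = j then 1 else 0) = M i j
  simp [mul_ite, tsum_ite_eq]

theorem matPow_add {ι : Type*} [DecidableEq ι] (M : ι → ι → ℝ≥0∞) (a b : ℕ) (i j : ι) :
    matPow M (a + b) i j = ∑' r, matPow M a i r * matPow M b r j := by
  induction a generalizing i with
  | zero =>
    rw [zero_add]
    show _ = ∑' r, (if i = r then 1 else 0) * matPow M b r j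
    simp only [ite_mul, one_mul, zero_mul]
    rw [tsum_ite_eq']
  | succ a ih =>
    rw [Nat.add_right_comm]
    show ∑' r, M i r * matPow M (a + b) r j = ∑' r, (∑' s, M i s * matPow M a s r) * matPow M b r j
    simp only [ih, ← ENNReal.tsum_mul_left, ← ENNReal.tsum_mul_right]
    rw [ENNReal.tsum_comm]
    simp only [mul_assoc]

theorem matPow_mul_le {ι : Type*} [DecidableEq ι] (M : ι → ι → ℝ≥0∞) (a b : ℕ) (i r j : ι) :
    matPow M a i r * matPow M b r j ≤ matPow M (a + b) i j := by
  rw [matPow_add]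
  exact ENNReal.le_tsum (f := fun r => matPow M a i r * matPow M b r j) r

/-- The hockey-stick identity, written as a sum over columns. -/
theorem tsum_choose {k : ℕ} (hk : 1 ≤ k) {m : ℕ} (hm : 1 ≤ m) :
    ∑' r : ℕ+, (if m ≤ r then ((2 * k + 1 - r).choose k : ℝ≥0∞) else 0) =
      (2 * k + 2 - m).choose (k + 1) := by
  have key : ∀ n ≤ 2 * k + 1,
      ∑' r : ℕ+, (if 2 * k + 2 - n ≤ r then ((2 * k + 1 - r).choose k : ℝ≥0∞) else 0) =
        n.choose (k + 1) := by
    intro n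
    induction n with
    | zero =>
      intro _
      rw [Nat.choose_zero_succ, Nat.cast_zero, ENNReal.tsum_eq_zero]
      intro r
      split_ifs with h
      · rw [show 2 * k + 1 - (r : ℕ) = 0 by omega, Nat.choose_eq_zero_of_lt (by omega),
          Nat.cast_zero]
      · rfl
    | succ n ih =>
      intro hn
      set r0 : ℕ+ := ⟨2 * k + 1 - n, by omega⟩ with hr0
      have hr0' : (r0 : ℕ) = 2 * k + 1 - n := rfl
      have : ∀ r : ℕ+,
          (if 2 * k + 2 - (n + 1) ≤ r then ((2 * k + 1 - r).choose k : ℝ≥0∞) else 0) =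
          (if r = r0 then (n.choose k : ℝ≥0∞) else 0) +
            (if 2 * k + 2 - n ≤ r then ((2 * k + 1 - r).choose k : ℝ≥0∞) else 0) := by
        intro r
        by_cases h : r = r0
        · subst h
          rw [if_pos (by omega), if_pos rfl, if_neg (by omega), hr0',
            show 2 * k + 1 - (2 * k + 1 - n) = n by omega, add_zero]
        · have h' : (r : ℕ) ≠ 2 * k + 1 - n := fun hc => h (PNat.coe_injective hc)
          rw [if_neg h, zero_add]
          congr 1
          exact propext (by omega)
      simp_rw [this]
      rw [ENNReal.tsum_add, ih (by omega), tsum_ite_eq, Nat.choose_succ_succ, Nat.cast_add]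
  rcases le_or_gt m (2 * k + 2) with h | h
  · have := key (2 * k + 2 - m) (by omega)
    rwa [show 2 * k + 2 - (2 * k + 2 - m) = m by omega] at this
  · rw [show 2 * k + 2 - m = 0 by omega, Nat.choose_zero_succ, Nat.cast_zero,
      ENNReal.tsum_eq_zero]
    intro r
    split_ifs with h
    · rw [show 2 * k + 1 - (r : ℕ) = 0 by omega, Nat.choose_eq_zero_of_lt (by omega),
        Nat.cast_zero]
    · rfl

theorem two_mul_choose_middle (k : ℕ) :
    (2 * k + 2).choose (k + 1) = 2 * (2 * k + 1).choose (k + 1) := by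
  rw [Nat.choose_succ_succ' (2 * k + 1) k, Nat.choose_symm_half]; ring

/-- The first column of the powers. This form is uniform in the row; in the first row the
binomial coefficient is the central one. -/
theorem matPow_nullMatrix_col {k : ℕ} (hk : 1 ≤ k) (i : ℕ+) :
    matPow nullMatrix k i 1 = ((2 * k + 1 - i).choose k : ℝ≥0∞) / 4 ^ k := by
  induction k, hk using Nat.le_induction generalizing i with
  | base =>
    rw [matPow_one, nullMatrix_eq]
    have h2 : i ≤ 1 + 1 ↔ (i : ℕ) ≤ 2 := by rw [← PNat.coe_le_coe]; rfl
    unfold weight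
    rcases eq_or_ne i 1 with rfl | h
    · rw [if_pos (by simp)]
      simp only [if_true, PNat.one_coe]
      rw [ENNReal.div_eq_div_iff] <;> norm_num
    · have h1 : (i : ℕ) ≠ 1 := fun hc => h (PNat.coe_eq_one_iff.mp hc)
      have := i.pos
      simp only [h, h2, if_false]
      split_ifs with h3
      · rw [show 2 * 1 + 1 - (i : ℕ) = 1 by omega]; simp
      · rw [show 2 * 1 + 1 - (i : ℕ) = 0 by omega]; simp
  | succ k hk ih =>
    show ∑' r, nullMatrix i r * matPow nullMatrix k r 1 = _
    have hterm : ∀ r : ℕ+, nullMatrix i r * matPow nullMatrix k r 1 =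
        weight i / 4 ^ k * (if (max 1 ((i : ℕ) - 1)) ≤ r then
          ((2 * k + 1 - r).choose k : ℝ≥0∞) else 0) := by
      intro r
      have h : i ≤ r + 1 ↔ max 1 ((i : ℕ) - 1) ≤ r := by
        rw [← PNat.coe_le_coe, PNat.add_coe, PNat.one_coe]
        have := r.pos
        omega
      rw [ih, nullMatrix_eq, ENNReal.div_eq_inv_mul, ENNReal.div_eq_inv_mul]
      simp only [h]
      split_ifs
      · ring
      · simp
    simp_rw [hterm]
    rw [ENNReal.tsum_mul_left, tsum_choose hk (le_max_left _ _)]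
    unfold weight
    rcases eq_or_ne i 1 with rfl | h
    · simp only [PNat.one_coe, Nat.sub_self, if_true]
      rw [show 2 * (k + 1) + 1 - 1 = 2 * k + 2 by omega, two_mul_choose_middle,
        show 2 * k + 2 - max 1 0 = 2 * k + 1 by simp, ENNReal.div_eq_inv_mul,
        ENNReal.div_eq_inv_mul, ENNReal.div_eq_inv_mul, pow_succ,
        ENNReal.mul_inv (by simp) (by simp)]
      push_cast
      have h4 : (4 : ℝ≥0∞)⁻¹ * 2 = 2⁻¹ := by
        rw [← ENNReal.toReal_eq_toReal_iff' (by finiteness) (by finiteness)]; norm_num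
      rw [mul_one, mul_assoc (4 ^ k)⁻¹ 4⁻¹, ← mul_assoc 4⁻¹ 2, h4, mul_assoc]
    · have h1 : (i : ℕ) ≠ 1 := fun hc => h (PNat.coe_eq_one_iff.mp hc)
      have := i.pos
      simp only [h, if_false]
      rw [show 2 * k + 2 - max 1 ((i : ℕ) - 1) = 2 * (k + 1) + 1 - (i : ℕ) by omega,
        ENNReal.div_eq_inv_mul, ENNReal.div_eq_inv_mul, ENNReal.div_eq_inv_mul, pow_succ,
        ENNReal.mul_inv (by simp) (by simp)]
      ring

/-- The first column of the powers, in the two-case form. -/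
theorem matPow_nullMatrix_col_cases {k : ℕ} (hk : 1 ≤ k) (i : ℕ+) :
    matPow nullMatrix k i 1 =
      if i = 1 then ((2 * k - 1).choose (k - 1) : ℝ≥0∞) / 2 ^ (2 * k - 1)
      else if (i : ℕ) ≤ k + 1 then
        ((2 * k + 1 - (i : ℕ)).choose (k + 1 - (i : ℕ)) : ℝ≥0∞) / 2 ^ (2 * k)
      else 0 := by
  rw [matPow_nullMatrix_col hk]
  have h4 : (4 : ℝ≥0∞) ^ k = 2 ^ (2 * k) := by rw [pow_mul]; norm_num
  have := i.pos
  split_ifs with h h'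
  · subst h
    obtain ⟨m, rfl⟩ : ∃ m, k = m + 1 := ⟨k - 1, by omega⟩
    rw [h4, PNat.one_coe, show 2 * (m + 1) + 1 - 1 = 2 * m + 2 by omega, two_mul_choose_middle,
      show 2 * (m + 1) - 1 = 2 * m + 1 by omega, Nat.add_sub_cancel, Nat.choose_symm_half,
      show 2 * (m + 1) = (2 * m + 1) + 1 by ring, pow_succ' 2 (2 * m + 1)]
    push_cast
    exact ENNReal.mul_div_mul_left _ _ (by simp) (by simp)
  · rw [h4]
    congr 2
    rw [← Nat.choose_symm (show k ≤ 2 * k + 1 - (i : ℕ) by omega)]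
    congr 1
    omega
  · rw [Nat.choose_eq_zero_of_lt]
    · simp
    · have h1 : (i : ℕ) ≠ 1 := fun hc => h (PNat.coe_eq_one_iff.mp hc)
      omega

/-! ### Growth of the powers -/

/-- The probability `C(2k,k) / 4ᵏ`. -/
def centralProb (k : ℕ) : ℝ := (Nat.centralBinom k : ℝ) / 4 ^ k

theorem centralProb_pos (k : ℕ) : 0 < centralProb k := by
  unfold centralProb
  have := Nat.centralBinom_pos k
  positivity

theorem centralProb_succ (k : ℕ) :
    (2 * (k : ℝ) + 2) * centralProb (k + 1) = (2 * k + 1) * centralProb k := by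
  have h : ((k : ℝ) + 1) * Nat.centralBinom (k + 1) = 2 * (2 * k + 1) * Nat.centralBinom k := by
    exact_mod_cast Nat.succ_mul_centralBinom_succ k
  unfold centralProb
  rw [pow_succ]
  field_simp
  linarith

theorem sq_centralProb_le (k : ℕ) : (2 * (k : ℝ) + 1) * centralProb k ^ 2 ≤ 1 := by
  induction k with
  | zero => simp [centralProb]
  | succ k ih =>
    have h := centralProb_succ k
    have h2 : (2 * (k : ℝ) + 2) ^ 2 * centralProb (k + 1) ^ 2 =
        (2 * k + 1) * ((2 * k + 1) * centralProb k ^ 2) := by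
      rw [← mul_pow, h]; ring
    have h3 : (2 * (k : ℝ) + 2) ^ 2 * centralProb (k + 1) ^ 2 ≤ 2 * k + 1 := by
      rw [h2]
      exact mul_le_of_le_one_right (by positivity) ih
    push_cast
    nlinarith [sq_nonneg (centralProb (k + 1)), mul_nonneg (Nat.cast_nonneg (α := ℝ) k)
      (sq_nonneg (centralProb (k + 1)))]

theorem one_le_sq_centralProb {k : ℕ} (hk : 1 ≤ k) : 1 ≤ 4 * (k : ℝ) * centralProb k ^ 2 := by
  induction k, hk using Nat.le_induction with
  | base => norm_num [centralProb, Nat.centralBinom]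
  | succ k hk ih =>
    have h := centralProb_succ k
    have hk0 : (1 : ℝ) ≤ k := by exact_mod_cast hk
    have h2 : (2 * (k : ℝ) + 2) ^ 2 * centralProb (k + 1) ^ 2 =
        (2 * k + 1) ^ 2 * centralProb k ^ 2 := by
      rw [← mul_pow, h]; ring
    have h3 : (k : ℝ) * (4 * (k + 1) * ((k + 1) * centralProb (k + 1) ^ 2)) ≥ k * (k + 1) := by
      have : (k : ℝ) * (4 * (k + 1) * ((k + 1) * centralProb (k + 1) ^ 2)) =
        k * ((2 * k + 1) ^ 2 * centralProb k ^ 2) := by rw [← h2]; ring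
      rw [this]
      nlinarith [mul_nonneg (sq_nonneg (2 * (k : ℝ) + 1)) (sub_nonneg.mpr ih)]
    have h4 : (0 : ℝ) < k * (k + 1) := by positivity
    push_cast
    nlinarith [h3]

theorem inv_sqrt_le_centralProb {k : ℕ} (hk : 1 ≤ k) :
    1 / 2 / Real.sqrt k ≤ centralProb k := by
  have hk0 : (0 : ℝ) < k := by exact_mod_cast hk
  rw [div_le_iff₀ (Real.sqrt_pos.mpr hk0)]
  refine (sq_le_sq₀ (by norm_num)
    (mul_nonneg (centralProb_pos k).le (Real.sqrt_nonneg _))).mp ?_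
  rw [mul_pow, Real.sq_sqrt hk0.le]
  linarith [one_le_sq_centralProb hk]

theorem inv_le_centralProb {k : ℕ} (hk : 1 ≤ k) : 1 / 2 / (k : ℝ) ≤ centralProb k := by
  have hk0 : (1 : ℝ) ≤ k := by exact_mod_cast hk
  refine le_trans ?_ (inv_sqrt_le_centralProb hk)
  gcongr
  rw [Real.sqrt_le_left (by linarith)]
  nlinarith

theorem centralProb_le_one (k : ℕ) : centralProb k ≤ 1 := by
  have := sq_centralProb_le k
  have := centralProb_pos k
  have : (0 : ℝ) ≤ k * centralProb k ^ 2 := by positivity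
  nlinarith

theorem tendsto_centralProb : Tendsto centralProb atTop (𝓝 0) := by
  have h : Tendsto (fun k : ℕ => Real.sqrt (1 / ((k : ℝ) + 1))) atTop (𝓝 0) := by
    have := tendsto_one_div_add_atTop_nhds_zero_nat (𝕜 := ℝ)
    have h0 := (Real.continuous_sqrt.tendsto 0).comp this
    rwa [Real.sqrt_zero] at h0
  refine squeeze_zero (fun k => (centralProb_pos k).le) (fun k => ?_) h
  refine Real.le_sqrt_of_sq_le ?_
  rw [le_div_iff₀ (by positivity)]
  have := sq_centralProb_le k
  nlinarith [mul_nonneg (Nat.cast_nonneg (α := ℝ) k) (sq_nonneg (centralProb k))]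

theorem matPow_one_one (k : ℕ) :
    matPow nullMatrix k 1 1 = ENNReal.ofReal (centralProb k) := by
  unfold centralProb
  rw [ENNReal.ofReal_div_of_pos (by positivity), ENNReal.ofReal_natCast,
    ENNReal.ofReal_pow (by norm_num)]
  rcases Nat.eq_zero_or_pos k with rfl | hk
  · simp [matPow]
  · rw [matPow_nullMatrix_col hk, Nat.centralBinom]
    simp

theorem matPow_self_one_ne_zero (i : ℕ+) : matPow nullMatrix i i 1 ≠ 0 := by
  have hi : 1 ≤ (i : ℕ) := i.pos
  rw [matPow_nullMatrix_col hi]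
  have : (2 * (i : ℕ) + 1 - i).choose i ≠ 0 := (Nat.choose_pos (by omega)).ne'
  simp [ENNReal.div_eq_zero_iff, this]

theorem nullMatrix_one_left (i : ℕ+) : nullMatrix 1 i = 1 / 2 := by simp [nullMatrix]

/-- Every entry of a power is bounded, up to a constant and a shift, by the first diagonal entry:
the paths from `i` to `j` are extended to loops at `1`. -/
theorem exists_mul_matPow_le (i j : ℕ+) : ∃ c : ℝ≥0∞, c ≠ 0 ∧ ∃ N : ℕ, ∀ n,
    c * matPow nullMatrix n i j ≤ matPow nullMatrix (n + N) 1 1 := by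
  refine ⟨nullMatrix 1 i * matPow nullMatrix j j 1,
    mul_ne_zero (by simp [nullMatrix_one_left]) (matPow_self_one_ne_zero j), 1 + j, fun n => ?_⟩
  calc nullMatrix 1 i * matPow nullMatrix j j 1 * matPow nullMatrix n i j
      = matPow nullMatrix 1 1 i * (matPow nullMatrix n i j * matPow nullMatrix j j 1) := by
        rw [matPow_one]; ring
    _ ≤ matPow nullMatrix 1 1 i * matPow nullMatrix (n + j) i 1 := by
        gcongr; exact matPow_mul_le _ _ _ _ _ _
    _ ≤ matPow nullMatrix (1 + (n + j)) 1 1 := matPow_mul_le _ _ _ _ _ _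
    _ = matPow nullMatrix (n + (1 + j)) 1 1 := by congr 1; omega

/-- Conversely, loops at `1` are extended to paths from `i` to `j`. -/
theorem exists_mul_matPow_one_le (i j : ℕ+) : ∃ c : ℝ≥0∞, c ≠ 0 ∧ ∃ N : ℕ, ∀ n,
    c * matPow nullMatrix n 1 1 ≤ matPow nullMatrix (n + N) i j := by
  refine ⟨matPow nullMatrix i i 1 * nullMatrix 1 j,
    mul_ne_zero (matPow_self_one_ne_zero i) (by simp [nullMatrix_one_left]), i + 1, fun n => ?_⟩
  calc matPow nullMatrix i i 1 * nullMatrix 1 j * matPow nullMatrix n 1 1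
      = matPow nullMatrix i i 1 * (matPow nullMatrix n 1 1 * matPow nullMatrix 1 1 j) := by
        rw [matPow_one]; ring
    _ ≤ matPow nullMatrix i i 1 * matPow nullMatrix (n + 1) 1 j := by
        gcongr; exact matPow_mul_le _ _ _ _ _ _
    _ ≤ matPow nullMatrix (i + (n + 1)) i j := matPow_mul_le _ _ _ _ _ _
    _ = matPow nullMatrix (n + (i + 1)) i j := by congr 1; omega

theorem exists_matPow_le (i j : ℕ+) : ∃ C : ℝ, 0 < C ∧ ∀ n,
    matPow nullMatrix n i j ≤ ENNReal.ofReal C := by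
  obtain ⟨c, hc, N, h⟩ := exists_mul_matPow_le i j
  have hle : ∀ n, matPow nullMatrix n i j ≤ c⁻¹ := by
    intro n
    have h1 : matPow nullMatrix n i j * c ≤ 1 := by
      rw [mul_comm]
      refine (h n).trans ?_
      rw [matPow_one_one, ← ENNReal.ofReal_one]
      exact ENNReal.ofReal_le_ofReal (centralProb_le_one _)
    rw [← one_div]
    exact (ENNReal.le_div_iff_mul_le (Or.inl hc) (Or.inr (by simp))).mpr h1
  refine ⟨c⁻¹.toReal + 1, by positivity, fun n => (hle n).trans ?_⟩
  rw [← ENNReal.ofReal_toReal (ENNReal.inv_ne_top.mpr hc)]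
  apply ENNReal.ofReal_le_ofReal
  rw [ENNReal.ofReal_toReal (ENNReal.inv_ne_top.mpr hc)]
  linarith

theorem tendsto_matPow (i j : ℕ+) :
    Tendsto (fun n => matPow nullMatrix n i j) atTop (𝓝 0) := by
  obtain ⟨c, hc, N, h⟩ := exists_mul_matPow_le i j
  have h1 : Tendsto (fun n => c⁻¹ * matPow nullMatrix (n + N) 1 1) atTop (𝓝 0) := by
    have h2 : Tendsto (fun n => matPow nullMatrix n 1 1) atTop (𝓝 0) := by
      simp only [matPow_one_one]
      rw [← ENNReal.ofReal_zero]
      exact ENNReal.tendsto_ofReal tendsto_centralProb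
    have h3 := ENNReal.Tendsto.const_mul (a := c⁻¹) (h2.comp (tendsto_add_atTop_nat N))
      (Or.inr (ENNReal.inv_ne_top.mpr hc))
    simpa using h3
  refine tendsto_of_tendsto_of_tendsto_of_le_of_le tendsto_const_nhds h1 (fun _ => zero_le)
    fun n => ?_
  show _ ≤ c⁻¹ * _
  rw [mul_comm, ← div_eq_mul_inv]
  have hct : c ≠ ∞ ∨ matPow nullMatrix (n + N) 1 1 ≠ 0 := by
    refine Or.inr ?_
    rw [matPow_one_one]
    simpa using centralProb_pos _
  refine (ENNReal.le_div_iff_mul_le (Or.inl hc) (Or.inr ?_)).mpr ?_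
  · rw [matPow_one_one]; exact ENNReal.ofReal_ne_top
  · rw [mul_comm]; exact h n

theorem exists_le_matPow (i j : ℕ+) : ∃ c : ℝ, 0 < c ∧ ∃ N : ℕ, ∀ n, N ≤ n →
    ENNReal.ofReal (c / n) ≤ matPow nullMatrix n i j := by
  obtain ⟨c, hc, N, h⟩ := exists_mul_matPow_one_le i j
  have hct : c ≠ ∞ := by
    intro hct
    obtain ⟨C, -, hC⟩ := exists_matPow_le i j
    have h0 := (h 0).trans (hC _)
    rw [hct, matPow_one_one] at h0
    simp [centralProb] at h0
  refine ⟨c.toReal / 2, by have := ENNReal.toReal_pos hc hct; positivity, N + 1, fun n hn => ?_⟩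
  obtain ⟨m, rfl⟩ : ∃ m, n = m + 1 + N := ⟨n - N - 1, by omega⟩
  refine le_trans ?_ (h (m + 1))
  have hle : (1 / 2 / ((m + 1 + N : ℕ) : ℝ)) ≤ centralProb (m + 1) := by
    refine le_trans ?_ (inv_le_centralProb (Nat.le_add_left 1 m))
    exact div_le_div_of_nonneg_left (by norm_num) (by positivity) (Nat.cast_le.mpr (by omega))
  rw [matPow_one_one]
  calc ENNReal.ofReal (c.toReal / 2 / ((m + 1 + N : ℕ) : ℝ))
      = ENNReal.ofReal (c.toReal * (1 / 2 / ((m + 1 + N : ℕ) : ℝ))) := by congr 1; ring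
    _ = c * ENNReal.ofReal (1 / 2 / ((m + 1 + N : ℕ) : ℝ)) := by
        rw [ENNReal.ofReal_mul ENNReal.toReal_nonneg, ENNReal.ofReal_toReal hct]
    _ ≤ _ := by gcongr

theorem tsum_matPow_succ (i j : ℕ+) : ∑' n, matPow nullMatrix (n + 1) i j = ∞ := by
  obtain ⟨c, hc, N, h⟩ := exists_le_matPow i j
  have h1 : ∑' n : ℕ, ENNReal.ofReal (c / ((n + N + 1 : ℕ) : ℝ)) = ∞ := by
    by_contra hne
    have hs := ENNReal.summable_toReal hne
    have h2 : (fun n : ℕ => (ENNReal.ofReal (c / ((n + N + 1 : ℕ) : ℝ))).toReal) =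
        fun n : ℕ => (fun k : ℕ => c * (1 / (k : ℝ))) (n + (N + 1)) := by
      funext n
      rw [ENNReal.toReal_ofReal (by positivity)]
      simp only [add_assoc, mul_one_div]
    rw [h2, summable_nat_add_iff (f := fun k : ℕ => c * (1 / (k : ℝ))),
      summable_mul_left_iff hc.ne'] at hs
    exact Real.not_summable_one_div_natCast hs
  rw [← top_le_iff, ← h1]
  calc ∑' n : ℕ, ENNReal.ofReal (c / ((n + N + 1 : ℕ) : ℝ))
      ≤ ∑' n, matPow nullMatrix (n + N + 1) i j :=
        ENNReal.tsum_le_tsum fun n => h _ (by omega)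
    _ ≤ ∑' n, matPow nullMatrix (n + 1) i j :=
        ENNReal.tsum_comp_le_tsum_of_injective (add_left_injective N)
          fun n => matPow nullMatrix (n + 1) i j

/-! ### Sums over periodic points -/

theorem tsum_subtype_eq_tsum_ite {X : Type*} (P : X → Prop) [DecidablePred P] (G : X → ℝ≥0∞) :
    ∑' x : {x // P x}, G x = ∑' x, if P x then G x else 0 := by
  have h := tsum_subtype {x | P x} G
  refine h.trans (tsum_congr fun x => ?_)
  by_cases hx : P x <;> simp [hx]

/-- A sum over the fibre of `F` is a sum over the inverse branches. -/
theorem tsum_fiber {l : ℝ} (hl : l ∈ Ioo (0 : ℝ) 1) (G : Ioc (0 : ℝ) 1 → ℝ≥0∞)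
    (x : Ioc (0 : ℝ) 1) :
    ∑' y : {y // F hl y = x}, G y =
      ∑' n : ℕ+, if n ≤ idx hl x + 1 then G (invBranch hl n x) else 0 := by
  let e : {n : ℕ+ // n ≤ idx hl x + 1} ≃ {y // F hl y = x} :=
    { toFun := fun n => ⟨invBranch hl n x, F_invBranch hl n.2⟩
      invFun := fun y => ⟨idx hl y, by simpa only [y.2] using idx_le_idx_F hl y⟩
      left_inv := fun n => Subtype.ext (idx_invBranch hl n.2)
      right_inv := fun y => by
        obtain ⟨y, rfl⟩ := y
        exact Subtype.ext (invBranch_F hl y) }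
  rw [← tsum_subtype_eq_tsum_ite (fun n : ℕ+ => n ≤ idx hl x + 1)
    (fun n => G (invBranch hl n x)), ← e.tsum_eq]
  rfl

/-- A sum over `W_i` is a sum over the image of the `i`-th branch. -/
theorem tsum_W {l : ℝ} (hl : l ∈ Ioo (0 : ℝ) 1) (i : ℕ+) (G : Ioc (0 : ℝ) 1 → ℝ≥0∞) :
    ∑' x, (if idx hl x = i then G x else 0) =
      ∑' z, if i ≤ idx hl z + 1 then G (invBranch hl i z) else 0 := by
  let e : {z // i ≤ idx hl z + 1} ≃ {x // idx hl x = i} :=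
    { toFun := fun z => ⟨invBranch hl i z, idx_invBranch hl z.2⟩
      invFun := fun x => ⟨F hl x, by simpa only [x.2] using idx_le_idx_F hl x⟩
      left_inv := fun z => Subtype.ext (F_invBranch hl z.2)
      right_inv := fun x => by
        obtain ⟨x, rfl⟩ := x
        exact Subtype.ext (invBranch_F hl x) }
  rw [← tsum_subtype_eq_tsum_ite (fun z => i ≤ idx hl z + 1) (fun z => G (invBranch hl i z)),
    ← tsum_subtype_eq_tsum_ite (fun x => idx hl x = i) G, ← e.tsum_eq]
  rfl

theorem tsum_branchImage {l : ℝ} (hl : l ∈ Ioo (0 : ℝ) 1) (i : ℕ+)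
    (H : Ioc (0 : ℝ) 1 → ℝ≥0∞) :
    ∑' z, (if i ≤ idx hl z + 1 then H z else 0) =
      ∑' r : ℕ+, if i ≤ r + 1 then ∑' z, (if idx hl z = r then H z else 0) else 0 := by
  have h1 : ∀ z, (if i ≤ idx hl z + 1 then H z else 0) =
      ∑' r : ℕ+, if r = idx hl z then (if i ≤ r + 1 then H z else 0) else 0 := by
    intro z; rw [tsum_ite_eq]
  simp_rw [h1]
  rw [ENNReal.tsum_comm]
  refine tsum_congr fun r => ?_
  split_ifs with h
  · simp only [eq_comm]
  · simp

theorem ofReal_exp_birkhoffSum_succ {X : Type*} (f : X → X) (φ : X → ℝ) (n : ℕ) (x : X) :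
    ENNReal.ofReal (Real.exp (birkhoffSum f φ (n + 1) x)) =
      ENNReal.ofReal (Real.exp (φ x)) * ENNReal.ofReal (Real.exp (birkhoffSum f φ n (f x))) := by
  rw [birkhoffSum_succ', Real.exp_add, ENNReal.ofReal_mul (Real.exp_pos _).le]

open Classical in
/-- The total weight of the paths of length `k` from `r` to `e` in the transition graph all of
whose vertices before the last one lie in `Q`. -/
def pathWeight (Q : Set ℕ+) (e : ℕ+) : ℕ → ℕ+ → ℝ≥0∞
  | 0, r => if r = e then 1 else 0
  | k + 1, r => if r ∈ Q then ∑' s, nullMatrix r s * pathWeight Q e k s else 0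

theorem pathWeight_univ (e : ℕ+) (k : ℕ) (r : ℕ+) :
    pathWeight univ e k r = matPow nullMatrix k r e := by
  induction k generalizing r with
  | zero => rfl
  | succ k ih => simp only [pathWeight, mem_univ, if_true, ih]; rfl

/-- An affine contraction that maps the closed interval `[λʳ, λʳ⁻¹]` into `W_e` has exactly one
fixed point in `W_r` if `r = e`, and none otherwise. -/
theorem tsum_fixed_affine {l : ℝ} (hl : l ∈ Ioo (0 : ℝ) 1) {e r : ℕ+} {a b : ℝ}
    (ha1 : a < 1)
    (hab : ∀ z ∈ Icc (l ^ (r : ℕ)) (l ^ ((r : ℕ) - 1)),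
      a * z + b ∈ Ioc (l ^ (e : ℕ)) (l ^ ((e : ℕ) - 1))) :
    ∑' z : Ioc (0 : ℝ) 1, (if idx hl z = r ∧ (z : ℝ) = a * z + b then 1 else 0) =
      (if r = e then 1 else 0 : ℝ≥0∞) := by
  have h1a : 0 < 1 - a := sub_pos.mpr ha1
  split_ifs with h
  · subst h
    have hle : l ^ (r : ℕ) ≤ l ^ ((r : ℕ) - 1) :=
      pow_le_pow_of_le_one hl.1.le hl.2.le (by omega)
    have hlow := (hab _ (left_mem_Icc.mpr hle)).1
    have hupp := (hab _ (right_mem_Icc.mpr hle)).2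
    have hx1 : l ^ (r : ℕ) < b / (1 - a) := by rw [lt_div_iff₀ h1a]; linarith
    have hx2 : b / (1 - a) ≤ l ^ ((r : ℕ) - 1) := by rw [div_le_iff₀ h1a]; linarith
    have hx : b / (1 - a) ∈ Ioc (0 : ℝ) 1 :=
      ⟨(pow_pos hl.1 _).trans hx1, hx2.trans (pow_le_one₀ hl.1.le hl.2.le)⟩
    have hiff : ∀ z : Ioc (0 : ℝ) 1, (idx hl z = r ∧ (z : ℝ) = a * z + b) ↔
        z = ⟨b / (1 - a), hx⟩ := by
      intro z
      rw [Subtype.ext_iff, eq_div_iff h1a.ne']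
      constructor
      · rintro ⟨-, hz⟩; linarith
      · intro hz
        refine ⟨?_, by linarith⟩
        rw [← mem_W_iff_idx]
        have hz' : (z : ℝ) = b / (1 - a) := by rw [eq_div_iff h1a.ne']; exact hz
        exact ⟨hz' ▸ hx1, hz' ▸ hx2⟩
    simp only [hiff]
    rw [tsum_ite_eq]
  · rw [ENNReal.tsum_eq_zero]
    rintro z
    rw [if_neg]
    rintro ⟨hz, hz'⟩
    have hW := (mem_W_iff_idx hl r z).mpr hz
    have := hab z ⟨hW.1.le, hW.2⟩
    rw [← hz'] at this
    exact h (hz.symm.trans ((mem_W_iff_idx hl e z).mp this))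

/-- The key to counting periodic points. The equation `Fᵏ z = τ z` with an affine contraction `τ`
into `W_e` passes to `Fᵏ⁻¹ z' = τ (g_r z')` for `z' = F z`, where `g_r` is the inverse branch, and
`τ ∘ g_r` is of the same kind. Hence the sum over its solutions obeys the recursion of
`pathWeight`, whatever `τ` is. -/
theorem tsum_iterate_eq_affine {l : ℝ} (hl : l ∈ Ioo (0 : ℝ) 1) {φ : Ioc (0 : ℝ) 1 → ℝ}
    (hφ : ∀ x, ENNReal.ofReal (Real.exp (φ x)) = weight (idx hl x)) (Q : Set ℕ+) (e : ℕ+)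
    (k : ℕ) {r : ℕ+} {a b : ℝ} (ha0 : 0 ≤ a) (ha1 : a < 1)
    (hab : ∀ z ∈ Icc (l ^ (r : ℕ)) (l ^ ((r : ℕ) - 1)),
      a * z + b ∈ Ioc (l ^ (e : ℕ)) (l ^ ((e : ℕ) - 1))) :
    (open Classical in
    ∑' z : Ioc (0 : ℝ) 1, if idx hl z = r then
      (if (∀ j < k, idx hl ((F hl)^[j] z) ∈ Q) ∧ ((F hl)^[k] z : ℝ) = a * z + b then
        ENNReal.ofReal (Real.exp (birkhoffSum (F hl) φ k z)) else 0) else 0) =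
      pathWeight Q e k r := by
  classical
  induction k generalizing r a b with
  | zero =>
    rw [pathWeight, ← tsum_fixed_affine hl ha1 hab]
    refine tsum_congr fun z => ?_
    by_cases h : idx hl z = r <;> simp [h]
  | succ k ih =>
    rw [tsum_W hl r, pathWeight]
    have hterm : ∀ z, (if r ≤ idx hl z + 1 then
        (if (∀ j < k + 1, idx hl ((F hl)^[j] (invBranch hl r z)) ∈ Q) ∧
          ((F hl)^[k + 1] (invBranch hl r z) : ℝ) = a * (invBranch hl r z : ℝ) + b then
        ENNReal.ofReal (Real.exp (birkhoffSum (F hl) φ (k + 1) (invBranch hl r z))) else 0)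
          else 0) =
        if r ≤ idx hl z + 1 then (if r ∈ Q then weight r else 0) *
          (if (∀ j < k, idx hl ((F hl)^[j] z) ∈ Q) ∧
            ((F hl)^[k] z : ℝ) = (a * ratio l r) * z + (a * l ^ (r : ℕ) + b) then
            ENNReal.ofReal (Real.exp (birkhoffSum (F hl) φ k z)) else 0) else 0 := by
      intro z
      by_cases h1 : r ≤ idx hl z + 1
      · have hiff : ((∀ j < k + 1, idx hl ((F hl)^[j] (invBranch hl r z)) ∈ Q) ∧
            ((F hl)^[k + 1] (invBranch hl r z) : ℝ) = a * (invBranch hl r z : ℝ) + b) ↔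
            r ∈ Q ∧ (∀ j < k, idx hl ((F hl)^[j] z) ∈ Q) ∧
            ((F hl)^[k] z : ℝ) = (a * ratio l r) * z + (a * l ^ (r : ℕ) + b) := by
          rw [Nat.forall_lt_succ_left']
          simp only [Function.iterate_succ_apply, F_invBranch hl h1, idx_invBranch hl h1,
            Function.iterate_zero, id, coe_invBranch, and_assoc]
          rw [show a * (l ^ (r : ℕ) + ratio l r * (z : ℝ)) + b =
            a * ratio l r * z + (a * l ^ (r : ℕ) + b) by ring]
        rw [if_pos h1, if_pos h1]
        simp only [hiff, ite_and (r ∈ Q)]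
        rw [ofReal_exp_birkhoffSum_succ, F_invBranch hl h1, hφ, idx_invBranch hl h1]
        by_cases hQ : r ∈ Q <;> simp [hQ]
      · rw [if_neg h1, if_neg h1]
    simp_rw [hterm]
    rw [tsum_branchImage hl r]
    split_ifs with hQ
    · refine tsum_congr fun s => ?_
      rw [nullMatrix_eq]
      split_ifs with hs
      · have hr := ratio_pos hl r
        rw [← ih (r := s) (a := a * ratio l r) (b := a * l ^ (r : ℕ) + b) (by positivity) ?_ ?_,
          ← ENNReal.tsum_mul_left]
        · simp only [mul_ite, mul_zero]
        · nlinarith [ratio_lt_one hl r]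
        · intro z hz
          have hz0 : 0 < z := (pow_pos hl.1 _).trans_le hz.1
          have hzr : z ≤ l ^ ((r : ℕ) - 2) := by
            refine hz.2.trans (pow_le_pow_of_le_one hl.1.le hl.2.le ?_)
            have : (r : ℕ) ≤ (s : ℕ) + 1 := by exact_mod_cast hs
            omega
          have := hab _ (Ioc_subset_Icc_self (pow_add_ratio_mul_mem hl r ⟨hz0, hzr⟩))
          convert this using 1
          ring
      · simp
    · simp

/-- The sum over the periodic points in `W_e` whose orbit stays in `Q` between the endpoints. -/
theorem tsum_periodic {l : ℝ} (hl : l ∈ Ioo (0 : ℝ) 1) {φ : Ioc (0 : ℝ) 1 → ℝ}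
    (hφ : ∀ x, ENNReal.ofReal (Real.exp (φ x)) = weight (idx hl x)) (Q : Set ℕ+) (e : ℕ+)
    (k : ℕ) {P : Ioc (0 : ℝ) 1 → Prop}
    (hP : ∀ x, P x ↔ x ∈ W l e ∧ (F hl)^[k + 1] x = x ∧
        ∀ j, 0 < j → j < k + 1 → idx hl ((F hl)^[j] x) ∈ Q) :
    ∑' x : {x // P x},
      ENNReal.ofReal (Real.exp (birkhoffSum (F hl) φ (k + 1) x)) =
      ∑' s, nullMatrix e s * pathWeight Q e k s := by
  classical
  rw [tsum_subtype_eq_tsum_ite P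
      (fun x => ENNReal.ofReal (Real.exp (birkhoffSum (F hl) φ (k + 1) x)))]
  simp only [hP, mem_W_iff_idx hl, ite_and (idx hl _ = e)]
  rw [tsum_W hl e]
  have hterm : ∀ z, (if e ≤ idx hl z + 1 then
      (if (F hl)^[k + 1] (invBranch hl e z) = invBranch hl e z ∧
          ∀ j, 0 < j → j < k + 1 → idx hl ((F hl)^[j] (invBranch hl e z)) ∈ Q then
      ENNReal.ofReal (Real.exp (birkhoffSum (F hl) φ (k + 1) (invBranch hl e z))) else 0)
        else 0) =
      if e ≤ idx hl z + 1 then weight e *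
        (if (∀ j < k, idx hl ((F hl)^[j] z) ∈ Q) ∧
          ((F hl)^[k] z : ℝ) = ratio l e * z + l ^ (e : ℕ) then
          ENNReal.ofReal (Real.exp (birkhoffSum (F hl) φ k z)) else 0) else 0 := by
    intro z
    by_cases h1 : e ≤ idx hl z + 1
    · have hiff : ((F hl)^[k + 1] (invBranch hl e z) = invBranch hl e z ∧
          ∀ j, 0 < j → j < k + 1 → idx hl ((F hl)^[j] (invBranch hl e z)) ∈ Q) ↔
          ((∀ j < k, idx hl ((F hl)^[j] z) ∈ Q) ∧
          ((F hl)^[k] z : ℝ) = ratio l e * z + l ^ (e : ℕ)) := by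
        rw [and_comm, Function.iterate_succ_apply, F_invBranch hl h1, Subtype.ext_iff,
          coe_invBranch, add_comm (l ^ (e : ℕ))]
        refine and_congr_left fun _ => ⟨fun h j hj => ?_, fun h j hj hjk => ?_⟩
        · have := h (j + 1) (by omega) (by omega)
          rwa [Function.iterate_succ_apply, F_invBranch hl h1] at this
        · obtain ⟨i, rfl⟩ : ∃ i, j = i + 1 := ⟨j - 1, by omega⟩
          rw [Function.iterate_succ_apply, F_invBranch hl h1]
          exact h i (by omega)
      rw [if_pos h1, if_pos h1]
      simp only [hiff]
      rw [ofReal_exp_birkhoffSum_succ, F_invBranch hl h1, hφ, idx_invBranch hl h1, mul_ite,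
        mul_zero]
    · rw [if_neg h1, if_neg h1]
  simp_rw [hterm]
  rw [tsum_branchImage hl e]
  refine tsum_congr fun s => ?_
  rw [nullMatrix_eq]
  split_ifs with hs
  · rw [← tsum_iterate_eq_affine hl hφ Q e k (ratio_pos hl e).le (ratio_lt_one hl e)
      (b := l ^ (e : ℕ)), ← ENNReal.tsum_mul_left]
    · simp only [mul_ite, mul_zero]
    · intro z hz
      have hz0 : 0 < z := (pow_pos hl.1 _).trans_le hz.1
      have hzr : z ≤ l ^ ((e : ℕ) - 2) := by
        refine hz.2.trans (pow_le_pow_of_le_one hl.1.le hl.2.le ?_)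
        have : (e : ℕ) ≤ (s : ℕ) + 1 := by exact_mod_cast hs
        omega
      rw [add_comm]
      exact pow_add_ratio_mul_mem hl e ⟨hz0, hzr⟩
  · simp

theorem localPartition_eq {l : ℝ} (hl : l ∈ Ioo (0 : ℝ) 1) {φ : Ioc (0 : ℝ) 1 → ℝ}
    (hφ : ∀ x, ENNReal.ofReal (Real.exp (φ x)) = weight (idx hl x)) (e : ℕ+) {k : ℕ}
    (hk : 1 ≤ k) :
    localPartition (F hl) φ k (W l e) = matPow nullMatrix k e e := by
  obtain ⟨k, rfl⟩ : ∃ i, k = i + 1 := ⟨k - 1, by omega⟩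
  refine (tsum_periodic hl hφ univ e k fun x => ?_).trans ?_
  · simp
  · simp only [pathWeight_univ]; rfl

theorem firstReturnPartition_eq {l : ℝ} (hl : l ∈ Ioo (0 : ℝ) 1) {φ : Ioc (0 : ℝ) 1 → ℝ}
    (hφ : ∀ x, ENNReal.ofReal (Real.exp (φ x)) = weight (idx hl x)) (e : ℕ+) (k : ℕ) :
    firstReturnPartition (F hl) φ (k + 1) (W l e) =
      ∑' s, nullMatrix e s * pathWeight {e}ᶜ e k s := by
  refine tsum_periodic hl hφ {e}ᶜ e k fun x => ?_
  simp only [mem_W_iff_idx hl, mem_compl_iff, mem_singleton_iff]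

/-! ### First returns and the renewal equation -/

/-- The weight of the first-return loops of length `k + 1` at `e`. -/
def firstReturnWeight (e : ℕ+) (k : ℕ) : ℝ≥0∞ := ∑' s, nullMatrix e s * pathWeight {e}ᶜ e k s

/-- Decomposition of the paths from `s` to `e` at their first visit of `e`. -/
theorem matPow_eq_sum_pathWeight (e : ℕ+) (n : ℕ) (s : ℕ+) :
    matPow nullMatrix n s e = ∑ k ∈ Finset.range (n + 1),
      pathWeight {e}ᶜ e k s * matPow nullMatrix (n - k) e e := by
  induction n generalizing s with
  | zero =>
    simp only [zero_add, Finset.sum_range_one, pathWeight, Nat.sub_zero]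
    by_cases h : s = e <;> simp [matPow, h]
  | succ n ih =>
    by_cases h : s = e
    · subst h
      rw [Finset.sum_range_succ']
      simp [pathWeight]
    · rw [Finset.sum_range_succ']
      simp only [pathWeight, mem_compl_iff, mem_singleton_iff, h, not_false_eq_true, if_true,
        if_false, zero_mul, add_zero, Nat.add_sub_add_right]
      show ∑' r, nullMatrix s r * matPow nullMatrix n r e = _
      simp only [ih, Finset.mul_sum, ← ENNReal.tsum_mul_right, mul_assoc]
      rw [Summable.tsum_finsetSum fun _ _ => ENNReal.summable]

theorem renewal_equation (e : ℕ+) (n : ℕ) :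
    matPow nullMatrix (n + 1) e e = ∑ k ∈ Finset.range (n + 1),
      firstReturnWeight e k * matPow nullMatrix (n - k) e e := by
  show ∑' r, nullMatrix e r * matPow nullMatrix n r e = _
  simp only [matPow_eq_sum_pathWeight e n, firstReturnWeight, Finset.mul_sum,
    ← ENNReal.tsum_mul_right, ← mul_assoc]
  rw [Summable.tsum_finsetSum fun _ _ => ENNReal.summable]

/-- In the recurrent case the return probabilities `f_k` (`k ≥ 0` standing for time `k + 1`) of a
renewal sequence `u` add up to at least one. -/
theorem one_le_tsum_of_renewal {u f : ℕ → ℝ≥0∞} (h0 : u 0 = 1) (hfin : ∀ n, u n ≠ ∞)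
    (hu : ∀ n, u (n + 1) = ∑ k ∈ Finset.range (n + 1), f k * u (n - k))
    (hsum : ∑' n, u n = ∞) : 1 ≤ ∑' k, f k := by
  by_contra! hlt
  set c := ∑' k, f k with hc
  have hpart : ∀ N, ∑ n ∈ Finset.range (N + 1), u n ≤
      1 + c * ∑ n ∈ Finset.range (N + 1), u n := by
    intro N
    have hfirst : ∑ n ∈ Finset.range (N + 1), u n = 1 + ∑ n ∈ Finset.range N, u (n + 1) := by
      rw [Finset.sum_range_succ', h0, add_comm]
    refine hfirst.trans_le (add_le_add_right ?_ 1)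
    calc ∑ n ∈ Finset.range N, u (n + 1)
        = ∑ n ∈ Finset.range N, ∑ k ∈ Finset.range (n + 1), f k * u (n - k) := by
          simp only [hu]
      _ = ∑ i ∈ Finset.range N, ∑ j ∈ Finset.range (N - i), f i * u j :=
          Finset.sum_range_diag_flip N fun i j => f i * u j
      _ ≤ ∑ i ∈ Finset.range N, f i * ∑ n ∈ Finset.range (N + 1), u n := by
          refine Finset.sum_le_sum fun i _ => ?_
          rw [← Finset.mul_sum]
          gcongr
          omega
      _ ≤ c * ∑ n ∈ Finset.range (N + 1), u n := by
          rw [← Finset.sum_mul]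
          gcongr
          exact ENNReal.sum_le_tsum _
  have hbound : ∀ N, ∑ n ∈ Finset.range N, u n ≤ (1 - c)⁻¹ := by
    intro N
    refine (Finset.sum_le_sum_of_subset (Finset.range_mono (Nat.le_succ N))).trans ?_
    set S := ∑ n ∈ Finset.range (N + 1), u n with hS
    have hSt : S ≠ ∞ := ENNReal.sum_ne_top.mpr fun n _ => hfin n
    rw [← one_div, ENNReal.le_div_iff_mul_le (Or.inl (tsub_pos_of_lt hlt).ne') (Or.inr (by simp)),
      ENNReal.mul_sub fun _ _ => hSt, mul_one, tsub_le_iff_right, mul_comm S c]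
    exact hpart N
  have htop := ENNReal.tsum_le_of_sum_range_le hbound
  rw [hsum, top_le_iff, ENNReal.inv_eq_top] at htop
  exact (tsub_pos_of_lt hlt).ne' htop

/-- A recurrent renewal sequence that tends to zero has infinite mean return time. With the tails
`r_k = ∑_{j ≥ k} f_j`, the sums `∑_{k ≤ n} r_k u_{n-k}` are nondecreasing in `n` and at least one,
while a finite mean `∑ r_k` would force them to tend to zero. -/
theorem tsum_mul_eq_top_of_renewal {u f : ℕ → ℝ≥0∞} (h0 : u 0 = 1) {C : ℝ≥0∞} (hC : C ≠ ∞)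
    (hfin : ∀ n, u n ≤ C)
    (hu : ∀ n, u (n + 1) = ∑ k ∈ Finset.range (n + 1), f k * u (n - k))
    (hsum : ∑' n, u n = ∞) (hlim : Tendsto u atTop (𝓝 0)) :
    ∑' k : ℕ, ((k : ℝ≥0∞) + 1) * f k = ∞ := by
  by_contra hmean
  set r : ℕ → ℝ≥0∞ := fun k => ∑' j, f (j + k) with hr
  have hr0 : 1 ≤ r 0 :=
    one_le_tsum_of_renewal h0 (fun n => ((hfin n).trans_lt hC.lt_top).ne) hu hsum
  have hrstep : ∀ k, r k = f k + r (k + 1) := by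
    intro k
    simp only [hr]
    rw [tsum_eq_zero_add' ENNReal.summable, zero_add]
    simp only [add_assoc, add_comm 1 k]
  have hrsum : ∑' k, r k = ∑' k : ℕ, ((k : ℝ≥0∞) + 1) * f k := by
    have h1 : ∀ k, r k = ∑' j, if k ≤ j then f j else 0 := by
      intro k
      rw [← ENNReal.summable.sum_add_tsum_nat_add'
        (f := fun j => if k ≤ j then f j else 0) (k := k)]
      rw [Finset.sum_eq_zero, zero_add]
      · simp [hr]
      · intro j hj
        rw [if_neg (by simpa using hj)]
    simp only [h1]
    rw [ENNReal.tsum_comm]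
    refine tsum_congr fun j => ?_
    rw [tsum_eq_sum (s := Finset.range (j + 1))]
    · rw [Finset.sum_congr rfl fun k hk => if_pos (by simpa [Nat.lt_succ_iff] using hk)]
      simp
    · intro k hk
      rw [if_neg (by simpa [Nat.lt_succ_iff] using hk)]
  set V : ℕ → ℝ≥0∞ := fun n => ∑ k ∈ Finset.range (n + 1), r k * u (n - k) with hV
  have hVstep : ∀ n, V n ≤ V (n + 1) := by
    intro n
    have h1 : V (n + 1) + u (n + 1) = r 0 * u (n + 1) + V n := by
      simp only [hV]
      rw [Finset.sum_range_succ', hu n]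
      simp only [Nat.add_sub_add_right, Nat.sub_zero]
      rw [add_right_comm, ← Finset.sum_add_distrib, add_comm]
      congr 1
      · rw [hu n]
      · refine Finset.sum_congr rfl fun k _ => ?_
        rw [hrstep k]; ring
    have h2 : u (n + 1) + V n ≤ u (n + 1) + V (n + 1) := by
      rw [add_comm _ (V (n + 1)), h1]
      gcongr
      exact le_mul_of_one_le_left zero_le hr0
    exact (ENNReal.add_le_add_iff_left ((hfin _).trans_lt hC.lt_top).ne).mp h2
  have hV1 : ∀ n, 1 ≤ V n := by
    intro n
    induction n with
    | zero => simpa [hV, h0] using hr0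
    | succ n ih => exact ih.trans (hVstep n)
  have hVlim : Tendsto V atTop (𝓝 0) := by
    have hVt : V = fun n => ∫⁻ k, (if k ≤ n then r k * u (n - k) else 0)
        ∂(Measure.count : Measure ℕ) := by
      funext n
      rw [lintegral_count, tsum_eq_sum (s := Finset.range (n + 1))]
      · exact Finset.sum_congr rfl fun k hk => by
          rw [if_pos (by simpa [Nat.lt_succ_iff] using hk)]
      · intro k hk
        rw [if_neg (by simpa [Nat.lt_succ_iff] using hk)]
    have hfinr : ∑' k, r k * C ≠ ∞ := by
      rw [ENNReal.tsum_mul_right, hrsum]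
      exact ENNReal.mul_ne_top hmean hC
    have hint : Tendsto V atTop (𝓝 (∫⁻ _ : ℕ, 0 ∂(Measure.count : Measure ℕ))) := by
      rw [hVt]
      refine tendsto_lintegral_of_dominated_convergence (fun k => r k * C)
        (fun n => measurable_of_countable _) (fun n => Eventually.of_forall fun k => ?_)
        (by rwa [lintegral_count]) (Eventually.of_forall fun k => ?_)
      · show (if k ≤ n then r k * u (n - k) else 0) ≤ r k * C
        split_ifs
        · gcongr; exact hfin _
        · exact zero_le
      · have hrk : r k ≠ ∞ := ENNReal.ne_top_of_tsum_ne_top (hrsum ▸ hmean) k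
        have h3 : Tendsto (fun n => r k * u (n - k)) atTop (𝓝 0) := by
          have := ENNReal.Tendsto.const_mul (a := r k) (hlim.comp (tendsto_sub_atTop_nat k))
            (Or.inr hrk)
          simpa using this
        refine h3.congr' ?_
        filter_upwards [eventually_ge_atTop k] with n hn
        rw [if_pos hn]
    rwa [lintegral_zero] at hint
  have := ge_of_tendsto' hVlim hV1
  simp at this

theorem tsum_mul_firstReturnWeight (e : ℕ+) :
    ∑' k : ℕ, ((k : ℝ≥0∞) + 1) * firstReturnWeight e k = ∞ := by
  obtain ⟨C, -, hC⟩ := exists_matPow_le e e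
  refine tsum_mul_eq_top_of_renewal (u := fun n => matPow nullMatrix n e e) (by simp [matPow])
    ENNReal.ofReal_ne_top hC (renewal_equation e) ?_ (tendsto_matPow e e)
  rw [tsum_eq_zero_add' ENNReal.summable, tsum_matPow_succ, add_top]

/-! ### Pressure and recurrence through partition functions -/

theorem ofReal_exp_birkhoffSum_sub {X : Type*} (f : X → X) (φ : X → ℝ) (p : ℝ) (n : ℕ) (x : X) :
    ENNReal.ofReal (Real.exp (birkhoffSum f φ n x)) = ENNReal.ofReal (Real.exp (n * p)) *
      ENNReal.ofReal (Real.exp (birkhoffSum f (fun y => φ y - p) n x)) := by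
  rw [← ENNReal.ofReal_mul (Real.exp_pos _).le, ← Real.exp_add]
  congr 2
  simp [birkhoffSum, Finset.sum_sub_distrib]

theorem localPartition_sub {X : Type*} (f : X → X) (φ : X → ℝ) (p : ℝ) (n : ℕ) (A : Set X) :
    localPartition f φ n A = ENNReal.ofReal (Real.exp (n * p)) *
      localPartition f (fun y => φ y - p) n A := by
  simp only [localPartition, ofReal_exp_birkhoffSum_sub f φ p n, ENNReal.tsum_mul_left]

theorem firstReturnPartition_sub {X : Type*} (f : X → X) (φ : X → ℝ) (p : ℝ) (n : ℕ)
    (A : Set X) :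
    firstReturnPartition f φ n A = ENNReal.ofReal (Real.exp (n * p)) *
      firstReturnPartition f (fun y => φ y - p) n A := by
  simp only [firstReturnPartition, ofReal_exp_birkhoffSum_sub f φ p n, ENNReal.tsum_mul_left]

/-- Polynomial bounds `c / n ≤ Z_n(φ - p, A) ≤ C` pin the Gurevich pressure to `p`. -/
theorem isGurevichPressure_of_bounds {X : Type*} {f : X → X} {φ : X → ℝ} {A : Set X} {p c C : ℝ}
    (hc : 0 < c) (hC : 0 < C)
    (hlow : ∀ᶠ n : ℕ in atTop,
      ENNReal.ofReal (c / n) ≤ localPartition f (fun x => φ x - p) n A)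
    (hupp : ∀ᶠ n : ℕ in atTop,
      localPartition f (fun x => φ x - p) n A ≤ ENNReal.ofReal C) :
    IsGurevichPressure f φ A p := by
  have hlog : ∀ {a : ℝ} {n : ℕ}, 0 < a → ENNReal.log (ENNReal.ofReal (Real.exp (n * p)) *
      ENNReal.ofReal a) / (n : EReal) = (((n * p + Real.log a) / n : ℝ) : EReal) := by
    intro a n ha
    rw [← ENNReal.ofReal_mul (Real.exp_pos _).le,
      ENNReal.log_ofReal_of_pos (mul_pos (Real.exp_pos _) ha),
      Real.log_mul (Real.exp_pos _).ne' ha.ne', Real.log_exp, EReal.coe_div]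
    rfl
  have hninf : Tendsto (fun n : ℕ => (n : ℝ)) atTop atTop := tendsto_natCast_atTop_atTop
  have hlogn : Tendsto (fun n : ℕ => Real.log n / n) atTop (𝓝 0) :=
    Real.isLittleO_log_id_atTop.tendsto_div_nhds_zero.comp hninf
  have hlim1 : Tendsto (fun n : ℕ => (n * p + Real.log (c / n)) / n) atTop (𝓝 p) := by
    have h1 : Tendsto (fun n : ℕ => p + Real.log c / n - Real.log n / n) atTop
        (𝓝 (p + 0 - 0)) :=
      (tendsto_const_nhds.add (tendsto_const_nhds.div_atTop hninf)).sub hlogn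
    rw [add_zero, sub_zero] at h1
    refine h1.congr' ?_
    filter_upwards [eventually_gt_atTop 0] with n hn
    have hn0 : (0 : ℝ) < n := by exact_mod_cast hn
    rw [Real.log_div hc.ne' hn0.ne']
    field_simp
    ring
  have hlim2 : Tendsto (fun n : ℕ => (n * p + Real.log C) / n) atTop (𝓝 p) := by
    have h1 : Tendsto (fun n : ℕ => p + Real.log C / n) atTop (𝓝 (p + 0)) :=
      tendsto_const_nhds.add (tendsto_const_nhds.div_atTop hninf)
    rw [add_zero] at h1
    refine h1.congr' ?_
    filter_upwards [eventually_gt_atTop 0] with n hn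
    have hn0 : (0 : ℝ) < n := by exact_mod_cast hn
    field_simp
  refine tendsto_of_tendsto_of_tendsto_of_le_of_le' (EReal.tendsto_coe.mpr hlim1)
    (EReal.tendsto_coe.mpr hlim2) ?_ ?_
  · filter_upwards [hlow, eventually_gt_atTop 0] with n hn hn0
    have hn1 : (0 : ℝ) < n := by exact_mod_cast hn0
    rw [← hlog (div_pos hc hn1), localPartition_sub f φ p]
    refine EReal.div_le_div_right_of_nonneg (by positivity) (ENNReal.log_le_log ?_)
    gcongr
  · filter_upwards [hupp] with n hn
    rw [← hlog hC, localPartition_sub f φ p]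
    refine EReal.div_le_div_right_of_nonneg (by positivity) (ENNReal.log_le_log ?_)
    gcongr

theorem isGurevichPressure_geomPotential {l t : ℝ} (hl : l ∈ Ioo (0 : ℝ) 1) (ht : l ^ t = 1 / 2)
    (e : ℕ+) : IsGurevichPressure (F hl) (geomPotential l t) (W l e) (pressure l t) := by
  have hφ := ofReal_exp_geomPotential_sub hl ht
  obtain ⟨C, hC, hupp⟩ := exists_matPow_le e e
  obtain ⟨c, hc, N, hlow⟩ := exists_le_matPow e e
  refine isGurevichPressure_of_bounds hc hC ?_ ?_
  · filter_upwards [eventually_ge_atTop N, eventually_ge_atTop 1] with n h1 h2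
    rw [localPartition_eq hl hφ e h2]
    exact hlow n h1
  · filter_upwards [eventually_ge_atTop 1] with n h2
    rw [localPartition_eq hl hφ e h2]
    exact hupp n

theorem ofReal_exp_mul_cancel (n : ℕ) (p : ℝ) (a : ℝ≥0∞) :
    ENNReal.ofReal (Real.exp (-((n : ℝ) + 1) * p)) *
      (ENNReal.ofReal (Real.exp ((n + 1 : ℕ) * p)) * a) = a := by
  rw [← mul_assoc, ← ENNReal.ofReal_mul (Real.exp_pos _).le, ← Real.exp_add]
  push_cast
  rw [show -((n : ℝ) + 1) * p + (n + 1) * p = 0 by ring, Real.exp_zero, ENNReal.ofReal_one,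
    one_mul]

theorem isNullRecurrent_geomPotential {l t : ℝ} (hl : l ∈ Ioo (0 : ℝ) 1) (ht : l ^ t = 1 / 2)
    (e : ℕ+) : IsNullRecurrent (F hl) (geomPotential l t) (W l e) := by
  have hφ := ofReal_exp_geomPotential_sub hl ht
  have hP := isGurevichPressure_geomPotential hl ht e
  refine ⟨⟨pressure l t, hP, ?_⟩, ?_⟩
  · simp only [localPartition_sub (F hl) (geomPotential l t) (pressure l t),
      ofReal_exp_mul_cancel, localPartition_eq hl hφ e (Nat.le_add_left 1 _)]
    exact tsum_matPow_succ e e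
  · rintro ⟨-, P, hP', hsum⟩
    have hPp : P = pressure l t := EReal.coe_injective (tendsto_nhds_unique hP' hP)
    rw [hPp] at hsum
    simp only [firstReturnPartition_sub (F hl) (geomPotential l t) (pressure l t), mul_assoc,
      ofReal_exp_mul_cancel, firstReturnPartition_eq hl hφ e] at hsum
    exact hsum.ne (tsum_mul_firstReturnWeight e)

/-! ### Conformal measures -/

/-- Conformality branch by branch: on `W_n`, the measure is the image of its restriction to the
image of the branch under the inverse branch, scaled by `c` times the weight of the branch. -/
def IsBranchConformal {l : ℝ} (hl : l ∈ Ioo (0 : ℝ) 1) (c : ℝ≥0∞)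
    (m : Measure (Ioc (0 : ℝ) 1)) : Prop :=
  ∀ (n : ℕ+) (A : Set (Ioc (0 : ℝ) 1)), MeasurableSet A →
    m (W l n ∩ A) = c * weight n * m ({y | n ≤ idx hl y + 1} ∩ invBranch hl n ⁻¹' A)

theorem image_F_inter {l : ℝ} (hl : l ∈ Ioo (0 : ℝ) 1) (n : ℕ+) (A : Set (Ioc (0 : ℝ) 1)) :
    F hl '' (W l n ∩ A) = {y | n ≤ idx hl y + 1} ∩ invBranch hl n ⁻¹' A := by
  ext y
  constructor
  · rintro ⟨x, ⟨hx, hA⟩, rfl⟩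
    rw [mem_W_iff_idx hl] at hx
    subst hx
    exact ⟨idx_le_idx_F hl x, by rwa [mem_preimage, invBranch_F]⟩
  · rintro ⟨hy, hA⟩
    exact ⟨invBranch hl n y, ⟨(mem_W_iff_idx hl _ _).mpr (idx_invBranch hl hy), hA⟩,
      F_invBranch hl hy⟩

theorem injOn_F_W {l : ℝ} (hl : l ∈ Ioo (0 : ℝ) 1) (n : ℕ+) : InjOn (F hl) (W l n) := by
  intro x hx y hy h
  rw [mem_W_iff_idx hl] at hx hy
  rw [← invBranch_F hl x, ← invBranch_F hl y, h, hx, hy]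

theorem measurableSet_branchImage {l : ℝ} (hl : l ∈ Ioo (0 : ℝ) 1) (n : ℕ+) :
    MeasurableSet {y | n ≤ idx hl y + 1} :=
  measurableSet_idx hl fun r => n ≤ r + 1

theorem iUnion_W_inter {l : ℝ} (hl : l ∈ Ioo (0 : ℝ) 1) (A : Set (Ioc (0 : ℝ) 1)) :
    ⋃ n, W l n ∩ A = A := by
  rw [← iUnion_inter, inter_eq_right]
  exact fun x _ => mem_iUnion.mpr ⟨idx hl x, (mem_W_iff_idx hl _ _).mpr rfl⟩

theorem pairwise_disjoint_W_inter {l : ℝ} (hl : l ∈ Ioo (0 : ℝ) 1)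
    (A : Set (Ioc (0 : ℝ) 1)) : Pairwise fun i j => Disjoint (W l i ∩ A) (W l j ∩ A) := by
  intro i j hij
  rw [Set.disjoint_left]
  rintro x ⟨hi, -⟩ ⟨hj, -⟩
  rw [mem_W_iff_idx hl] at hi hj
  exact hij (hi.symm.trans hj)

theorem measure_eq_tsum_W {l : ℝ} (hl : l ∈ Ioo (0 : ℝ) 1) (m : Measure (Ioc (0 : ℝ) 1))
    {A : Set (Ioc (0 : ℝ) 1)} (hA : MeasurableSet A) : m A = ∑' n, m (W l n ∩ A) := by
  conv_lhs => rw [← iUnion_W_inter hl A]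
  exact measure_iUnion (pairwise_disjoint_W_inter hl A) fun n => (measurableSet_W l n).inter hA

theorem setLIntegral_eq_tsum_W {l : ℝ} (hl : l ∈ Ioo (0 : ℝ) 1) (m : Measure (Ioc (0 : ℝ) 1))
    {A : Set (Ioc (0 : ℝ) 1)} (hA : MeasurableSet A) (G : Ioc (0 : ℝ) 1 → ℝ≥0∞) :
    ∫⁻ x in A, G x ∂m = ∑' n, ∫⁻ x in W l n ∩ A, G x ∂m := by
  conv_lhs => rw [← iUnion_W_inter hl A]
  exact lintegral_iUnion (fun n => (measurableSet_W l n).inter hA)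
    (pairwise_disjoint_W_inter hl A) G

theorem isConformal_iff_isBranchConformal {l : ℝ} (hl : l ∈ Ioo (0 : ℝ) 1)
    {φ : Ioc (0 : ℝ) 1 → ℝ} {c : ℝ≥0∞} (hc0 : c ≠ 0) (hct : c ≠ ∞)
    (hφ : ∀ x, ENNReal.ofReal (Real.exp (φ x)) = c * weight (idx hl x))
    (m : Measure (Ioc (0 : ℝ) 1)) :
    IsConformal (F hl) φ m ↔ IsBranchConformal hl c m := by
  have hw0 : ∀ n, c * weight n ≠ 0 := fun n => mul_ne_zero hc0 (weight_ne_zero n)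
  have hwt : ∀ n, c * weight n ≠ ∞ := fun n => ENNReal.mul_ne_top hct (weight_ne_top n)
  have hinv : ∀ x, ENNReal.ofReal (Real.exp (-φ x)) = (c * weight (idx hl x))⁻¹ := by
    intro x
    rw [Real.exp_neg, ENNReal.ofReal_inv_of_pos (Real.exp_pos _), hφ]
  have hint : ∀ n {A : Set (Ioc (0 : ℝ) 1)}, MeasurableSet A →
      ∫⁻ x in W l n ∩ A, ENNReal.ofReal (Real.exp (-φ x)) ∂m =
        (c * weight n)⁻¹ * m (W l n ∩ A) := by
    intro n A hA
    rw [← setLIntegral_const]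
    refine setLIntegral_congr_fun ((measurableSet_W l n).inter hA) fun x hx => ?_
    show ENNReal.ofReal (Real.exp (-φ x)) = _
    rw [hinv, (mem_W_iff_idx hl n x).mp hx.1]
  constructor
  · intro h n A hA
    have := h _ ((measurableSet_W l n).inter hA) ((injOn_F_W hl n).mono inter_subset_left)
    rw [hint n hA, image_F_inter hl] at this
    rw [this, ← mul_assoc, ENNReal.mul_inv_cancel (hw0 n) (hwt n), one_mul]
  · intro h A hA hinj
    have himg : F hl '' A = ⋃ n, F hl '' (W l n ∩ A) := by
      rw [← image_iUnion, iUnion_W_inter hl]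
    rw [himg, setLIntegral_eq_tsum_W hl m hA, measure_iUnion]
    · refine tsum_congr fun n => ?_
      rw [hint n hA, h n A hA, image_F_inter hl, ← mul_assoc,
        ENNReal.inv_mul_cancel (hw0 n) (hwt n), one_mul]
    · intro i j hij
      exact disjoint_image_image fun x hx y hy hxy => by
        have := hinj hx.2 hy.2 hxy
        subst this
        exact (Set.disjoint_left.mp (pairwise_disjoint_W_inter hl A hij)) hx hy
    · intro n
      rw [image_F_inter hl]
      exact (measurableSet_branchImage hl n).inter (measurable_invBranch hl n hA)

/-- The part `(0, λⁿ]` of the interval. -/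
def tail {l : ℝ} (hl : l ∈ Ioo (0 : ℝ) 1) (n : ℕ) : Set (Ioc (0 : ℝ) 1) := {x | n < idx hl x}

theorem measurableSet_tail {l : ℝ} (hl : l ∈ Ioo (0 : ℝ) 1) (n : ℕ) :
    MeasurableSet (tail hl n) :=
  measurableSet_idx hl fun r => n < r

theorem measure_tail {l : ℝ} (hl : l ∈ Ioo (0 : ℝ) 1) (m : Measure (Ioc (0 : ℝ) 1)) (n : ℕ) :
    m (tail hl n) = m (W l n.succPNat) + m (tail hl (n + 1)) := by
  rw [← measure_union _ (measurableSet_tail hl _)]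
  · congr 1
    ext x
    rw [mem_union, mem_W_iff_idx hl, ← PNat.coe_inj, Nat.succPNat_coe]
    simp only [tail, mem_ofPred_eq]
    omega
  · rw [Set.disjoint_left]
    intro x hx
    rw [mem_W_iff_idx hl, ← PNat.coe_inj, Nat.succPNat_coe] at hx
    simp only [tail, mem_ofPred_eq]
    omega

theorem IsBranchConformal.measure_W {l : ℝ} {hl : l ∈ Ioo (0 : ℝ) 1} {c : ℝ≥0∞}
    {m : Measure (Ioc (0 : ℝ) 1)} (h : IsBranchConformal hl c m) (n : ℕ+) :
    m (W l n) = c * weight n * m {y | n ≤ idx hl y + 1} := by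
  simpa using h n univ MeasurableSet.univ

/-- The recursion for the measures of the sets `(0, λⁿ]`. -/
theorem IsBranchConformal.tail_recursion {l : ℝ} {hl : l ∈ Ioo (0 : ℝ) 1} {c : ℝ} (hc : 0 < c)
    {m : Measure (Ioc (0 : ℝ) 1)} [IsProbabilityMeasure m]
    (h : IsBranchConformal hl (ENNReal.ofReal c) m) :
    m.real (tail hl 0) = 1 ∧ m.real (tail hl 1) = 1 - c / 2 ∧
      ∀ n, m.real (tail hl (n + 2)) = m.real (tail hl (n + 1)) - c / 4 * m.real (tail hl n) := by
  have h0 : tail hl 0 = univ := by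
    ext x
    simp [tail, PNat.pos]
  have hstep : ∀ n, m.real (tail hl n) = m.real (W l n.succPNat) + m.real (tail hl (n + 1)) := by
    intro n
    simp only [Measure.real, measure_tail hl m n]
    exact ENNReal.toReal_add (measure_ne_top m _) (measure_ne_top m _)
  have hW : ∀ n, m.real (W l n) =
      c * (weight n).toReal * m.real {y | n ≤ idx hl y + 1} := by
    intro n
    simp only [Measure.real, h.measure_W n, ENNReal.toReal_mul, ENNReal.toReal_ofReal hc.le]
  have h00 : m.real (tail hl 0) = 1 := by rw [h0]; simp
  refine ⟨h00, ?_, fun n => ?_⟩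
  · have h1 := hstep 0
    have h2 : {y | Nat.succPNat 0 ≤ idx hl y + 1} = univ := by
      ext y; simp [← PNat.coe_le_coe]
    rw [h00, hW, h2] at h1
    have hw : (weight (Nat.succPNat 0)).toReal = 1 / 2 := by
      rw [show Nat.succPNat 0 = 1 from rfl]; simp [weight]
    rw [hw] at h1
    simp only [probReal_univ] at h1
    linarith
  · have h1 := hstep (n + 1)
    have h2 : {y | Nat.succPNat (n + 1) ≤ idx hl y + 1} = tail hl n := by
      ext y
      simp only [tail, mem_ofPred_eq, ← PNat.coe_le_coe, Nat.succPNat_coe, PNat.add_coe,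
        PNat.one_coe]
      omega
    rw [hW, h2] at h1
    have hw : (weight (Nat.succPNat (n + 1))).toReal = 1 / 4 := by
      have : Nat.succPNat (n + 1) ≠ 1 := by
        rw [Ne, ← PNat.coe_inj, Nat.succPNat_coe, PNat.one_coe]; omega
      simp [weight, this]
    rw [hw] at h1
    linarith

/-- The recursion `T_{n+2} = T_{n+1} - κ T_n` with `κ > 1/4` (complex characteristic roots) has no
nonnegative nonincreasing solution: the ratios `T_{n+1} / T_n` decrease by at least `κ - 1/4` in
each step. -/
theorem false_of_recursion {T : ℕ → ℝ} {κ : ℝ} (hκ : 1 / 4 < κ) (h0 : 0 < T 0)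
    (hnn : ∀ n, 0 ≤ T n) (hanti : ∀ n, T (n + 1) ≤ T n)
    (hrec : ∀ n, T (n + 2) = T (n + 1) - κ * T n) : False := by
  have hpos : ∀ n, 0 < T n := by
    intro n
    induction n with
    | zero => exact h0
    | succ n ih =>
      have h1 := hrec n
      have h2 := hnn (n + 2)
      nlinarith
  have hs1 : ∀ n, T (n + 1) / T n ≤ 1 := fun n => (div_le_one (hpos n)).mpr (hanti n)
  have hstep : ∀ n, T (n + 2) / T (n + 1) ≤ T (n + 1) / T n - (κ - 1 / 4) := by
    intro n
    have ha := hpos n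
    have hb := hpos (n + 1)
    have hsp : 0 < T (n + 1) / T n := div_pos hb ha
    have h1 : T (n + 2) / T (n + 1) = 1 - κ * (T (n + 1) / T n)⁻¹ := by
      rw [hrec]; field_simp
    rw [h1]
    set s := T (n + 1) / T n with hs
    have h2 : s * s⁻¹ = 1 := mul_inv_cancel₀ hsp.ne'
    have h3 : 1 ≤ s⁻¹ := (one_le_inv₀ hsp).mpr (hs1 n)
    have h4 : 1 ≤ s + 1 / 4 * s⁻¹ := by
      have h5 : s * (s + 1 / 4 * s⁻¹ - 1) = (s - 1 / 2) ^ 2 := by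
        linear_combination (1 / 4) * h2
      have h6 : 0 ≤ s * (s + 1 / 4 * s⁻¹ - 1) := h5 ▸ sq_nonneg _
      have := nonneg_of_mul_nonneg_right h6 hsp
      linarith
    nlinarith
  have hn : ∀ n : ℕ, T (n + 1) / T n ≤ 1 - n * (κ - 1 / 4) := by
    intro n
    induction n with
    | zero => simpa using hs1 0
    | succ n ih => push_cast; linarith [hstep n]
  obtain ⟨n, hnn'⟩ := exists_nat_gt (1 / (κ - 1 / 4))
  rw [div_lt_iff₀ (by linarith)] at hnn'
  have := div_pos (hpos (n + 1)) (hpos n)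
  linarith [hn n]

theorem IsBranchConformal.le_one {l : ℝ} {hl : l ∈ Ioo (0 : ℝ) 1} {c : ℝ} (hc : 0 < c)
    {m : Measure (Ioc (0 : ℝ) 1)} [IsProbabilityMeasure m]
    (h : IsBranchConformal hl (ENNReal.ofReal c) m) : c ≤ 1 := by
  by_contra! hlt
  obtain ⟨h0, -, hrec⟩ := h.tail_recursion hc
  refine false_of_recursion (T := fun n => m.real (tail hl n)) (κ := c / 4) (by linarith)
    (by simp [h0]) (fun n => measureReal_nonneg) (fun n => ?_) hrec
  exact measureReal_mono fun x (hx : n + 1 < _) => Nat.lt_of_succ_lt hx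

theorem IsBranchConformal.measure_tail {l : ℝ} {hl : l ∈ Ioo (0 : ℝ) 1}
    {m : Measure (Ioc (0 : ℝ) 1)} [IsProbabilityMeasure m]
    (h : IsBranchConformal hl 1 m) (n : ℕ) : m.real (tail hl n) = (1 / 2) ^ n := by
  rw [← ENNReal.ofReal_one] at h
  obtain ⟨h0, h1, hrec⟩ := h.tail_recursion one_pos
  have : ∀ n, m.real (tail hl n) = (1 / 2) ^ n ∧ m.real (tail hl (n + 1)) = (1 / 2) ^ (n + 1) := by
    intro n
    induction n with
    | zero => exact ⟨by simpa using h0, by rw [h1]; norm_num⟩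
    | succ n ih =>
      refine ⟨ih.2, ?_⟩
      rw [hrec, ih.1, ih.2]
      ring
  exact (this n).1

theorem IsBranchConformal.two_pow_mul_measure_W {l : ℝ} {hl : l ∈ Ioo (0 : ℝ) 1}
    {m : Measure (Ioc (0 : ℝ) 1)} [IsProbabilityMeasure m]
    (h : IsBranchConformal hl 1 m) (n : ℕ+) : 2 ^ (n : ℕ) * m (W l n) = 1 := by
  obtain ⟨k, rfl⟩ : ∃ k : ℕ, n = k.succPNat := ⟨n.natPred, (PNat.succPNat_natPred n).symm⟩
  have h1 : m.real (tail hl k) = m.real (W l k.succPNat) + m.real (tail hl (k + 1)) := by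
    simp only [Measure.real, ConformalMarkov.measure_tail hl m k]
    exact ENNReal.toReal_add (measure_ne_top m _) (measure_ne_top m _)
  rw [h.measure_tail, h.measure_tail] at h1
  have h2 : m.real (W l k.succPNat) = (1 / 2) ^ (k + 1) := by
    rw [pow_succ] at h1 ⊢; linarith
  rw [← ENNReal.toReal_eq_one_iff, ENNReal.toReal_mul, ← Measure.real, h2, Nat.succPNat_coe,
    ENNReal.toReal_pow, ENNReal.toReal_ofNat, ← mul_pow]
  norm_num

/-- The self-similarity of the distribution function of a conformal measure. -/
theorem IsBranchConformal.measureReal_Iic {l : ℝ} {hl : l ∈ Ioo (0 : ℝ) 1}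
    {m : Measure (Ioc (0 : ℝ) 1)} [IsProbabilityMeasure m]
    (h : IsBranchConformal hl 1 m) (x : Ioc (0 : ℝ) 1) :
    m.real (Iic x) = (weight (idx hl x)).toReal * m.real (Iic (F hl x)) +
      (1 / 2) ^ (idx hl x : ℕ) := by
  set n := idx hl x with hn
  have hr := ratio_pos hl n
  have hsplit : Iic x = (W l n ∩ Iic x) ∪ tail hl n := by
    ext y
    simp only [mem_Iic, mem_union, mem_inter_iff, mem_W_iff_idx hl]
    constructor
    · intro hy
      have h1 : (y : ℝ) ≤ l ^ ((n : ℕ) - 1) := le_trans hy (idx_upper hl x)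
      rw [le_pow_iff hl] at h1
      rcases eq_or_ne (idx hl y) n with h2 | h2
      · exact Or.inl ⟨h2, hy⟩
      · refine Or.inr ?_
        rw [Ne, ← PNat.coe_inj] at h2
        show (n : ℕ) < idx hl y
        omega
    · rintro (⟨-, hy⟩ | hy)
      · exact hy
      · have h1 : (y : ℝ) ≤ l ^ (n : ℕ) := (le_pow_iff hl y n).mpr hy
        exact h1.trans (idx_lower hl x).le
  have hdisj : Disjoint (W l n ∩ Iic x) (tail hl n) := by
    rw [Set.disjoint_left]
    rintro y ⟨hy, -⟩ hy'
    rw [mem_W_iff_idx hl] at hy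
    rw [tail, mem_ofPred_eq, hy] at hy'
    exact lt_irrefl _ hy'
  have himg : {y | n ≤ idx hl y + 1} ∩ invBranch hl n ⁻¹' Iic x = Iic (F hl x) := by
    ext y
    have h1 : invBranch hl n y ≤ x ↔ y ≤ F hl x := by
      rw [← Subtype.coe_le_coe, ← Subtype.coe_le_coe, coe_invBranch, F_coe, le_div_iff₀ hr]
      constructor <;> intro h <;> linarith
    simp only [mem_inter_iff, mem_ofPred_eq, mem_preimage, mem_Iic, h1, and_iff_right_iff_imp]
    intro hy
    rw [← le_pow_sub_two_iff]
    exact le_trans hy ((le_pow_sub_two_iff hl _ _).mpr (idx_le_idx_F hl x))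
  conv_lhs => rw [hsplit]
  rw [measureReal_union hdisj (measurableSet_tail hl n), h.measure_tail]
  simp only [Measure.real, h n _ measurableSet_Iic, himg, one_mul, ENNReal.toReal_mul]

theorem weight_toReal_le (n : ℕ+) : (weight n).toReal ≤ 1 / 2 := by
  unfold weight; split_ifs <;> norm_num

/-- Two distribution functions with the same self-similarity agree, since the self-similarity
contracts their distance by the factor `1/2`. -/
theorem IsBranchConformal.unique {l : ℝ} {hl : l ∈ Ioo (0 : ℝ) 1}
    {m m' : Measure (Ioc (0 : ℝ) 1)} [IsProbabilityMeasure m] [IsProbabilityMeasure m']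
    (h : IsBranchConformal hl 1 m) (h' : IsBranchConformal hl 1 m') : m = m' := by
  have hbound : ∀ (k : ℕ) x, |m.real (Iic x) - m'.real (Iic x)| ≤ (1 / 2) ^ k := by
    intro k
    induction k with
    | zero =>
      intro x
      have h1 : m.real (Iic x) ≤ 1 := measureReal_le_one
      have h2 : m'.real (Iic x) ≤ 1 := measureReal_le_one
      have h3 : 0 ≤ m.real (Iic x) := measureReal_nonneg
      have h4 : 0 ≤ m'.real (Iic x) := measureReal_nonneg
      rw [pow_zero, abs_le]
      constructor <;> linarith
    | succ k ih =>
      intro x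
      rw [h.measureReal_Iic x, h'.measureReal_Iic x, add_sub_add_right_eq_sub, ← mul_sub,
        abs_mul, abs_of_nonneg ENNReal.toReal_nonneg, pow_succ']
      exact mul_le_mul (weight_toReal_le _) (ih _) (abs_nonneg _) (by norm_num)
  refine Measure.ext_of_Iic m m' fun x => ?_
  have hlim : Tendsto (fun k : ℕ => (1 / 2 : ℝ) ^ k) atTop (𝓝 0) :=
    tendsto_pow_atTop_nhds_zero_of_lt_one (by norm_num) (by norm_num)
  have h0 := ge_of_tendsto' hlim fun k => hbound k x
  have h1 := sub_eq_zero.mp (abs_nonpos_iff.mp h0)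
  exact (ENNReal.toReal_eq_toReal_iff' (measure_ne_top m _) (measure_ne_top m' _)).mp h1

/-! ### Existence of the conformal measure -/

theorem half_mem_Ioo : (1 / 2 : ℝ) ∈ Ioo (0 : ℝ) 1 := by constructor <;> norm_num

theorem ofReal_ratio_half (n : ℕ+) : ENNReal.ofReal (ratio (1 / 2) n) = weight n := by
  unfold ratio weight
  split_ifs
  · rw [show (1 - 1 / 2 : ℝ) = 1 / 2 by norm_num, ENNReal.ofReal_div_of_pos (by norm_num)]; simp
  · rw [show (1 / 2 * (1 - 1 / 2) : ℝ) = 1 / 4 by norm_num,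
      ENNReal.ofReal_div_of_pos (by norm_num)]
    simp

/-- Lebesgue measure on `(0,1]`. -/
def unitLebesgue : Measure (Ioc (0 : ℝ) 1) := volume.comap Subtype.val

open scoped Pointwise in
/-- For `λ = 1/2` the weights are the contraction ratios, and Lebesgue measure is conformal. -/
theorem isBranchConformal_unitLebesgue :
    IsBranchConformal half_mem_Ioo 1 unitLebesgue := by
  intro n A hA
  have hr := ratio_pos half_mem_Ioo n
  set B := {y | n ≤ idx half_mem_Ioo y + 1} ∩ invBranch half_mem_Ioo n ⁻¹' A with hB
  have himg : (Subtype.val '' (W (1 / 2) n ∩ A) : Set ℝ) =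
      (fun x => (1 / 2 : ℝ) ^ (n : ℕ) + x) '' (ratio (1 / 2) n • (Subtype.val '' B : Set ℝ)) := by
    ext x
    simp only [mem_image, mem_smul_set, smul_eq_mul]
    constructor
    · rintro ⟨x, ⟨hx, hxA⟩, rfl⟩
      have hF : F half_mem_Ioo x ∈ B := by
        rw [hB, ← image_F_inter]
        exact mem_image_of_mem _ ⟨hx, hxA⟩
      refine ⟨_, ⟨_, ⟨_, hF, rfl⟩, rfl⟩, ?_⟩
      have := congrArg Subtype.val (invBranch_F half_mem_Ioo x)
      rwa [(mem_W_iff_idx half_mem_Ioo n x).mp hx] at this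
    · rintro ⟨_, ⟨_, ⟨y, ⟨hy, hyA⟩, rfl⟩, rfl⟩, rfl⟩
      exact ⟨invBranch half_mem_Ioo n y,
        ⟨(mem_W_iff_idx half_mem_Ioo _ _).mpr (idx_invBranch half_mem_Ioo hy), hyA⟩, rfl⟩
  have hvol : ∀ S : Set (Ioc (0 : ℝ) 1), unitLebesgue S = volume (Subtype.val '' S : Set ℝ) :=
    fun S => comap_subtype_coe_apply measurableSet_Ioc volume S
  rw [hvol, himg, image_add_left, measure_preimage_add, Measure.addHaar_smul, hvol B, one_mul,
    Module.finrank_self, pow_one, abs_of_pos hr, ofReal_ratio_half]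

/-- The approximation, from the first `k` steps of the itinerary of `u` under `F_{1/2}`, of the
point that has this itinerary under `F_λ`. -/
def approxCode (l : ℝ) : ℕ → Ioc (0 : ℝ) 1 → ℝ
  | 0, _ => 0
  | k + 1, u => l ^ (idx half_mem_Ioo u : ℕ) +
      ratio l (idx half_mem_Ioo u) * approxCode l k (F half_mem_Ioo u)

theorem approxCode_mem {l : ℝ} (hl : l ∈ Ioo (0 : ℝ) 1) (k : ℕ) (u : Ioc (0 : ℝ) 1) :
    approxCode l k u ∈ Icc 0 (l ^ ((idx half_mem_Ioo u : ℕ) - 1)) := by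
  induction k generalizing u with
  | zero => exact ⟨le_rfl, pow_nonneg hl.1.le _⟩
  | succ k ih =>
    have hr := ratio_pos hl (idx half_mem_Ioo u)
    obtain ⟨h1, h2⟩ := ih (F half_mem_Ioo u)
    have h0 := pow_pos hl.1 (idx half_mem_Ioo u : ℕ)
    refine ⟨by rw [approxCode]; positivity, ?_⟩
    rw [approxCode, ← pow_add_ratio_mul]
    gcongr
    refine h2.trans (pow_le_pow_of_le_one hl.1.le hl.2.le ?_)
    have h3 := idx_le_idx_F half_mem_Ioo u
    rw [← PNat.coe_le_coe, PNat.add_coe, PNat.one_coe] at h3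
    omega

theorem approxCode_mono {l : ℝ} (hl : l ∈ Ioo (0 : ℝ) 1) (u : Ioc (0 : ℝ) 1) :
    Monotone fun k => approxCode l k u := by
  refine monotone_nat_of_le_succ fun k => ?_
  induction k generalizing u with
  | zero => exact (approxCode_mem hl 1 u).1
  | succ k ih =>
    have hr := ratio_pos hl (idx half_mem_Ioo u)
    have := ih (F half_mem_Ioo u)
    rw [approxCode, approxCode]
    gcongr

theorem measurable_approxCode {l : ℝ} (k : ℕ) : Measurable (approxCode l k) := by
  induction k with
  | zero => exact measurable_const
  | succ k ih =>
    exact (measurable_comp_idx half_mem_Ioo fun n : ℕ+ => l ^ (n : ℕ)).add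
      ((measurable_comp_idx half_mem_Ioo (ratio l)).mul (ih.comp (measurable_F half_mem_Ioo)))

/-- The point whose itinerary under `F_λ` is the itinerary of `u` under `F_{1/2}`. -/
def codeReal (l : ℝ) (u : Ioc (0 : ℝ) 1) : ℝ := ⨆ k, approxCode l k u

theorem tendsto_approxCode {l : ℝ} (hl : l ∈ Ioo (0 : ℝ) 1) (u : Ioc (0 : ℝ) 1) :
    Tendsto (fun k => approxCode l k u) atTop (𝓝 (codeReal l u)) :=
  tendsto_atTop_ciSup (approxCode_mono hl u)
    ⟨_, by rintro _ ⟨k, rfl⟩; exact (approxCode_mem hl k u).2⟩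

theorem codeReal_eq {l : ℝ} (hl : l ∈ Ioo (0 : ℝ) 1) (u : Ioc (0 : ℝ) 1) :
    codeReal l u = l ^ (idx half_mem_Ioo u : ℕ) +
      ratio l (idx half_mem_Ioo u) * codeReal l (F half_mem_Ioo u) :=
  tendsto_nhds_unique ((tendsto_approxCode hl u).comp (tendsto_add_atTop_nat 1))
    (((tendsto_approxCode hl (F half_mem_Ioo u)).const_mul _).const_add _)

theorem codeReal_mem {l : ℝ} (hl : l ∈ Ioo (0 : ℝ) 1) (u : Ioc (0 : ℝ) 1) :
    codeReal l u ∈ Ioc (l ^ (idx half_mem_Ioo u : ℕ)) (l ^ ((idx half_mem_Ioo u : ℕ) - 1)) := by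
  have hlow : ∀ v, l ^ (idx half_mem_Ioo v : ℕ) ≤ codeReal l v := by
    intro v
    rw [codeReal_eq hl]
    have := mul_nonneg (ratio_pos hl (idx half_mem_Ioo v)).le
      (ge_of_tendsto' (tendsto_approxCode hl (F half_mem_Ioo v))
        fun k => (approxCode_mem hl k _).1)
    linarith
  refine ⟨?_, le_of_tendsto' (tendsto_approxCode hl u) fun k => (approxCode_mem hl k u).2⟩
  rw [codeReal_eq hl]
  have := mul_pos (ratio_pos hl (idx half_mem_Ioo u))
    ((pow_pos hl.1 _).trans_le (hlow (F half_mem_Ioo u)))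
  linarith

/-- The conjugacy from `F_{1/2}` to `F_λ`. -/
def code {l : ℝ} (hl : l ∈ Ioo (0 : ℝ) 1) (u : Ioc (0 : ℝ) 1) : Ioc (0 : ℝ) 1 :=
  ⟨codeReal l u, (pow_pos hl.1 _).trans (codeReal_mem hl u).1,
    (codeReal_mem hl u).2.trans (pow_le_one₀ hl.1.le hl.2.le)⟩

theorem measurable_code {l : ℝ} (hl : l ∈ Ioo (0 : ℝ) 1) : Measurable (code hl) :=
  Measurable.subtype_mk (measurable_of_tendsto_metrizable (fun k => measurable_approxCode k)
    (tendsto_pi_nhds.mpr fun u => tendsto_approxCode hl u))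

theorem idx_code {l : ℝ} (hl : l ∈ Ioo (0 : ℝ) 1) (u : Ioc (0 : ℝ) 1) :
    idx hl (code hl u) = idx half_mem_Ioo u :=
  (mem_W_iff_idx hl _ _).mp (codeReal_mem hl u)

theorem code_invBranch {l : ℝ} (hl : l ∈ Ioo (0 : ℝ) 1) {n : ℕ+} {v : Ioc (0 : ℝ) 1}
    (h : n ≤ idx half_mem_Ioo v + 1) :
    code hl (invBranch half_mem_Ioo n v) = invBranch hl n (code hl v) := by
  apply Subtype.ext
  show codeReal l _ = l ^ (n : ℕ) + ratio l n * codeReal l v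
  rw [codeReal_eq hl, idx_invBranch half_mem_Ioo h, F_invBranch half_mem_Ioo h]

/-- The conjugacy transports the conformality of Lebesgue measure. -/
theorem isBranchConformal_map_code {l : ℝ} (hl : l ∈ Ioo (0 : ℝ) 1) :
    IsBranchConformal hl 1 (unitLebesgue.map (code hl)) := by
  intro n A hA
  rw [Measure.map_apply (measurable_code hl) ((measurableSet_W l n).inter hA),
    Measure.map_apply (measurable_code hl)
      ((measurableSet_branchImage hl n).inter (measurable_invBranch hl n hA))]
  have h1 : code hl ⁻¹' (W l n ∩ A) = W (1 / 2) n ∩ code hl ⁻¹' A := by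
    ext u
    simp only [mem_preimage, mem_inter_iff, mem_W_iff_idx hl, mem_W_iff_idx half_mem_Ioo, idx_code]
  have h2 : code hl ⁻¹' ({y | n ≤ idx hl y + 1} ∩ invBranch hl n ⁻¹' A) =
      {y | n ≤ idx half_mem_Ioo y + 1} ∩ invBranch half_mem_Ioo n ⁻¹' (code hl ⁻¹' A) := by
    ext u
    simp only [mem_preimage, mem_inter_iff, mem_ofPred_eq, idx_code]
    refine and_congr_right fun h => ?_
    rw [code_invBranch hl h]
  rw [h1, h2]
  exact isBranchConformal_unitLebesgue n _ (measurable_code hl hA)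

theorem isProbabilityMeasure_map_code {l : ℝ} (hl : l ∈ Ioo (0 : ℝ) 1) :
    IsProbabilityMeasure (unitLebesgue.map (code hl)) := by
  have : IsProbabilityMeasure unitLebesgue :=
    ⟨by rw [unitLebesgue, comap_subtype_coe_apply measurableSet_Ioc, image_univ,
      Subtype.range_coe, Real.volume_Ioc]; simp⟩
  exact Measure.isProbabilityMeasure_map (measurable_code hl).aemeasurable

/-! ### Conservativity and absence of absolutely continuous invariant probabilities -/

variable {l : ℝ} {hl : l ∈ Ioo (0 : ℝ) 1} {m : Measure (Ioc (0 : ℝ) 1)}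

theorem IsBranchConformal.measure_W_inter_preimage (h : IsBranchConformal hl 1 m) (i : ℕ+)
    {A : Set (Ioc (0 : ℝ) 1)} (hA : MeasurableSet A) :
    m (W l i ∩ F hl ⁻¹' A) = weight i * m ({y | i ≤ idx hl y + 1} ∩ A) := by
  rw [h i _ (measurable_F hl hA), one_mul]
  congr 2
  ext y
  simp only [mem_inter_iff, mem_ofPred_eq, mem_preimage]
  refine and_congr_right fun hy => ?_
  rw [F_invBranch hl hy]

theorem IsBranchConformal.measure_W_one_inter_preimage (h : IsBranchConformal hl 1 m)
    {A : Set (Ioc (0 : ℝ) 1)} (hA : MeasurableSet A) :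
    m (W l 1 ∩ F hl ⁻¹' A) = 1 / 2 * m A := by
  rw [h.measure_W_inter_preimage 1 hA]
  congr 2
  ext y
  simp

/-- The powers of the transition matrix are the transition probabilities of the conformal
measure. -/
theorem IsBranchConformal.measure_W_inter_iterate (h : IsBranchConformal hl 1 m) (k : ℕ)
    (i : ℕ+) {A : Set (Ioc (0 : ℝ) 1)} (hA : MeasurableSet A) :
    m (W l i ∩ (F hl)^[k] ⁻¹' A) = ∑' j, matPow nullMatrix k i j * m (W l j ∩ A) := by
  induction k generalizing i with
  | zero =>
    show m (W l i ∩ A) = ∑' j, (if i = j then 1 else 0) * m (W l j ∩ A)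
    simp only [ite_mul, one_mul, zero_mul]
    rw [tsum_ite_eq']
  | succ k ih =>
    have hm := (measurable_F hl).iterate k hA
    rw [Function.iterate_succ, preimage_comp, h.measure_W_inter_preimage i hm,
      measure_eq_tsum_W hl m ((measurableSet_branchImage hl i).inter hm), ← ENNReal.tsum_mul_left]
    show _ = ∑' j, (∑' r, nullMatrix i r * matPow nullMatrix k r j) * m (W l j ∩ A)
    simp only [← ENNReal.tsum_mul_right]
    rw [ENNReal.tsum_comm]
    refine tsum_congr fun r => ?_
    simp only [mul_assoc]
    rw [ENNReal.tsum_mul_left, ← ih, nullMatrix_eq]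
    split_ifs with hir
    · congr 2
      ext x
      simp only [mem_inter_iff, mem_W_iff_idx hl, mem_ofPred_eq]
      constructor
      · rintro ⟨h1, -, h2⟩; exact ⟨h1, h2⟩
      · rintro ⟨h1, h2⟩; exact ⟨h1, h1 ▸ hir, h2⟩
    · have : W l r ∩ ({y | i ≤ idx hl y + 1} ∩ (F hl)^[k] ⁻¹' A) = ∅ := by
        ext x
        simp only [mem_inter_iff, mem_W_iff_idx hl, mem_ofPred_eq, mem_empty_iff_false, iff_false]
        rintro ⟨h1, h2, -⟩
        exact hir (h1 ▸ h2)
      rw [this]; simp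

theorem IsBranchConformal.isNonsingular (h : IsBranchConformal hl 1 m) :
    IsNonsingular (F hl) m := by
  intro A hA
  constructor
  · intro h0
    rw [measure_eq_tsum_W hl m (measurable_F hl hA), ENNReal.tsum_eq_zero]
    intro i
    rw [h.measure_W_inter_preimage i hA, measure_mono_null inter_subset_right h0, mul_zero]
  · intro h0
    have h1 := measure_mono_null (inter_subset_right (s := W l 1)) h0
    rw [h.measure_W_one_inter_preimage hA] at h1
    simpa using h1

/-- The preimages of a wandering set cut disjoint pieces of total measure
`∑ₙ (Dⁿ)₁ⱼ m(W_j ∩ S)` out of `W_1`, and `∑ₙ (Dⁿ)₁ⱼ` diverges. -/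
theorem IsBranchConformal.isConservative [IsProbabilityMeasure m] (h : IsBranchConformal hl 1 m) :
    IsConservative (F hl) m := by
  refine ⟨h.isNonsingular, fun S hS hwand => ?_⟩
  rw [measure_eq_tsum_W hl m hS, ENNReal.tsum_eq_zero]
  intro j
  by_contra hne
  have hle : ∑' n, m (W l 1 ∩ (F hl)^[n + 1] ⁻¹' S) ≤ 1 := by
    rw [← measure_iUnion]
    · exact prob_le_one
    · intro a b hab
      have := hwand (i := a + 1) (j := b + 1) (by simpa using hab)
      exact this.mono inter_subset_right inter_subset_right
    · exact fun n => (measurableSet_W l 1).inter ((measurable_F hl).iterate _ hS)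
  have htop : ∑' n, m (W l 1 ∩ (F hl)^[n + 1] ⁻¹' S) = ∞ := by
    rw [← top_le_iff]
    calc ∞ = ∑' n, matPow nullMatrix (n + 1) 1 j * m (W l j ∩ S) := by
          rw [ENNReal.tsum_mul_right, tsum_matPow_succ, ENNReal.top_mul hne]
      _ ≤ _ := by
          refine ENNReal.tsum_le_tsum fun n => ?_
          rw [h.measure_W_inter_iterate _ _ hS]
          exact ENNReal.le_tsum (f := fun j => matPow nullMatrix (n + 1) 1 j * m (W l j ∩ S)) j
  rw [htop] at hle
  simp at hle

theorem IsBranchConformal.tendsto_measure_preimage_W [IsProbabilityMeasure m]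
    (h : IsBranchConformal hl 1 m) (j : ℕ+) :
    Tendsto (fun n => m ((F hl)^[n] ⁻¹' W l j)) atTop (𝓝 0) := by
  have hle : ∀ n, m ((F hl)^[n] ⁻¹' W l j) ≤ 2 * matPow nullMatrix (n + 1) 1 j := by
    intro n
    have h1 := h.measure_W_one_inter_preimage
      ((measurable_F hl).iterate n (measurableSet_W l j))
    rw [← preimage_comp, ← Function.iterate_succ,
      h.measure_W_inter_iterate _ _ (measurableSet_W l j)] at h1
    have h2 : ∑' r, matPow nullMatrix (n + 1) 1 r * m (W l r ∩ W l j) ≤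
        matPow nullMatrix (n + 1) 1 j := by
      rw [tsum_eq_single j]
      · exact mul_le_of_le_one_right zero_le prob_le_one
      · intro r hr
        have : W l r ∩ W l j = ∅ := by
          ext x
          simp only [mem_inter_iff, mem_W_iff_idx hl, mem_empty_iff_false, iff_false]
          rintro ⟨rfl, h2⟩
          exact hr h2
        rw [this]; simp
    calc m ((F hl)^[n] ⁻¹' W l j) = 2 * (1 / 2 * m ((F hl)^[n] ⁻¹' W l j)) := by
          rw [← mul_assoc, one_div, ENNReal.mul_inv_cancel (by simp) (by simp), one_mul]
      _ ≤ _ := by rw [← h1]; gcongr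
  have hlim := ENNReal.Tendsto.const_mul (a := 2)
    ((tendsto_matPow 1 j).comp (tendsto_add_atTop_nat 1)) (Or.inr (by simp))
  rw [mul_zero] at hlim
  exact tendsto_of_tendsto_of_tendsto_of_le_of_le tendsto_const_nhds hlim (fun _ => zero_le) hle

/-- An absolutely continuous invariant probability measure would give every `W_j` the measure
`μ(F⁻ⁿ W_j)`, which tends to zero together with `m(F⁻ⁿ W_j)`. -/
theorem IsBranchConformal.not_exists_invariant [IsProbabilityMeasure m]
    (h : IsBranchConformal hl 1 m) :
    ¬ ∃ μ : Measure (Ioc (0 : ℝ) 1),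
      IsProbabilityMeasure μ ∧ MeasurePreserving (F hl) μ μ ∧ μ ≪ m := by
  rintro ⟨μ, hprob, hinv, hac⟩
  have hμ : ∀ S, μ S = ∫⁻ x in S, μ.rnDeriv m x ∂m := fun S => by
    rw [← withDensity_apply' _ S, Measure.withDensity_rnDeriv_eq μ m hac]
  have h0 : ∀ j, μ (W l j) = 0 := by
    intro j
    have hlim : Tendsto (fun n => μ ((F hl)^[n] ⁻¹' W l j)) atTop (𝓝 0) := by
      simp only [hμ]
      exact tendsto_setLIntegral_zero (Measure.lintegral_rnDeriv_lt_top μ m).ne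
        (h.tendsto_measure_preimage_W j)
    have hconst : ∀ n, μ ((F hl)^[n] ⁻¹' W l j) = μ (W l j) := fun n =>
      (hinv.iterate n).measure_preimage (measurableSet_W l j).nullMeasurableSet
    simp only [hconst] at hlim
    exact tendsto_nhds_unique tendsto_const_nhds hlim
  have h1 : μ univ = 0 := by
    rw [measure_eq_tsum_W hl μ MeasurableSet.univ]
    simp [h0]
  rw [measure_univ] at h1
  exact one_ne_zero h1

/-! ### Eigenfunctions of the transfer operator -/

/-- The eigenvalue equation for the normalised transfer operator. -/
theorem transfer_eigenvalue_iff {t : ℝ} (ht : l ^ t = 1 / 2)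
    {ρ : Ioc (0 : ℝ) 1 → ℝ} (x : Ioc (0 : ℝ) 1) :
    (∑' y : {y // F hl y = x}, ENNReal.ofReal (Real.exp (geomPotential l t y) * ρ y) =
      ENNReal.ofReal (Real.exp (pressure l t) * ρ x)) ↔
    ∑' n, nullMatrix n (idx hl x) * ENNReal.ofReal (ρ (invBranch hl n x)) =
      ENNReal.ofReal (ρ x) := by
  have hexp : ∀ y, ENNReal.ofReal (Real.exp (geomPotential l t y)) =
      ENNReal.ofReal (Real.exp (pressure l t)) * weight (idx hl y) := by
    intro y
    rw [← ofReal_exp_geomPotential_sub hl ht, ← ENNReal.ofReal_mul (Real.exp_pos _).le,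
      ← Real.exp_add]
    congr 2
    ring
  have hp0 : ENNReal.ofReal (Real.exp (pressure l t)) ≠ 0 := by simp [Real.exp_pos]
  rw [tsum_fiber hl (fun y => ENNReal.ofReal (Real.exp (geomPotential l t y) * ρ y))]
  have hterm : ∀ n, (if n ≤ idx hl x + 1 then ENNReal.ofReal
      (Real.exp (geomPotential l t (invBranch hl n x)) * ρ (invBranch hl n x)) else 0) =
      ENNReal.ofReal (Real.exp (pressure l t)) *
        (nullMatrix n (idx hl x) * ENNReal.ofReal (ρ (invBranch hl n x))) := by
    intro n
    rw [nullMatrix_eq]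
    split_ifs with h
    · rw [ENNReal.ofReal_mul (Real.exp_pos _).le, hexp, idx_invBranch hl h, mul_assoc]
    · simp
  simp only [hterm]
  rw [ENNReal.tsum_mul_left, ENNReal.ofReal_mul (Real.exp_pos _).le,
    ENNReal.mul_right_inj hp0 ENNReal.ofReal_ne_top]

/-- The vector `2ⁿ` is a left eigenvector of the transition matrix. -/
theorem tsum_nullMatrix_mul_two_pow (j : ℕ+) :
    ∑' n, nullMatrix n j * 2 ^ (n : ℕ) = 2 ^ (j : ℕ) := by
  have h14 : (1 / 4 : ℝ≥0∞) * 4 = 1 := ENNReal.div_mul_cancel (by simp) (by simp)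
  induction j using PNat.recOn with
  | one =>
    have hterm : ∀ n : ℕ+, nullMatrix n 1 * 2 ^ (n : ℕ) =
        (if n = 1 then 1 else 0) + (if n = 2 then 1 else 0) := by
      intro n
      rcases eq_or_ne n 1 with rfl | h1
      · simp [nullMatrix, ENNReal.inv_mul_cancel]
      · rcases eq_or_ne n 2 with rfl | h2
        · simp only [nullMatrix, h1, if_false, zero_add, if_true]
          norm_num
          simpa using h14
        · have h3 : ¬ (n : ℕ) ≤ ((1 : ℕ+) : ℕ) + 1 := by
            rw [Ne, ← PNat.coe_inj] at h1 h2
            have := n.pos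
            simp only [PNat.val_ofNat] at h1 h2 ⊢
            omega
          simp only [nullMatrix, h1, h2, h3, if_false, zero_mul, add_zero]
    simp only [hterm]
    rw [ENNReal.tsum_add, tsum_ite_eq, tsum_ite_eq]
    norm_num
  | succ j ih =>
    have hterm : ∀ n : ℕ+, nullMatrix n (j + 1) * 2 ^ (n : ℕ) =
        nullMatrix n j * 2 ^ (n : ℕ) + (if n = j + 2 then 2 ^ (j : ℕ) else 0) := by
      intro n
      have h2 : n = j + 2 ↔ (n : ℕ) = j + 2 := by rw [← PNat.coe_inj]; rfl
      rcases eq_or_ne n 1 with rfl | h1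
      · have : (1 : ℕ+) ≠ j + 2 := by
          rw [Ne, h2, PNat.one_coe]; omega
        simp [nullMatrix, this]
      · have h4 : (n : ℕ) ≤ ((j + 1 : ℕ+) : ℕ) + 1 ↔ (n : ℕ) ≤ (j : ℕ) + 2 := Iff.rfl
        simp only [nullMatrix, h1, if_false, h2, h4]
        by_cases h3 : (n : ℕ) = j + 2
        · rw [if_pos h3.le, if_neg (by omega), if_pos h3, h3, zero_mul, zero_add, pow_add,
            mul_comm ((2 : ℝ≥0∞) ^ (j : ℕ)), ← mul_assoc, show (2 : ℝ≥0∞) ^ 2 = 4 by norm_num,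
            h14, one_mul]
        · rw [if_neg h3, add_zero]
          congr 2
          exact propext (by omega)
    simp only [hterm]
    rw [ENNReal.tsum_add, tsum_ite_eq, ih, PNat.add_coe, PNat.one_coe, pow_succ]
    ring

theorem isPositiveEigenfunction_two_pow {t : ℝ} (hl : l ∈ Ioo (0 : ℝ) 1) (ht : l ^ t = 1 / 2) :
    IsPositiveEigenfunction (F hl) (geomPotential l t) (Real.exp (pressure l t))
      fun x => 2 ^ (idx hl x : ℕ) := by
  refine ⟨measurable_comp_idx hl fun n : ℕ+ => (2 : ℝ) ^ (n : ℕ), fun x => by positivity,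
    fun x => ?_⟩
  refine (transfer_eigenvalue_iff ht (ρ := fun x => 2 ^ (idx hl x : ℕ))
    x).mpr ?_
  have hpow : ∀ k : ℕ, ENNReal.ofReal ((2 : ℝ) ^ k) = 2 ^ k := fun k => by
    rw [ENNReal.ofReal_pow (by norm_num)]; simp
  simp only [hpow]
  rw [← tsum_nullMatrix_mul_two_pow]
  refine tsum_congr fun n => ?_
  rw [nullMatrix_eq]
  split_ifs with h
  · rw [idx_invBranch hl h]
  · simp

theorem IsBranchConformal.setLIntegral_W (h : IsBranchConformal hl 1 m) (n : ℕ+)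
    {G : Ioc (0 : ℝ) 1 → ℝ≥0∞} (hG : Measurable G) :
    ∫⁻ x in W l n, G x ∂m =
      weight n * ∫⁻ y in {y | n ≤ idx hl y + 1}, G (invBranch hl n y) ∂m := by
  have hres : m.restrict (W l n) =
      weight n • (m.restrict {y | n ≤ idx hl y + 1}).map (invBranch hl n) := by
    refine Measure.ext fun A hA => ?_
    rw [Measure.restrict_apply hA, inter_comm, h n A hA, one_mul, Measure.smul_apply,
      smul_eq_mul, Measure.map_apply (measurable_invBranch hl n) hA,
      Measure.restrict_apply (measurable_invBranch hl n hA), inter_comm]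
  rw [hres, lintegral_smul_measure, smul_eq_mul, lintegral_map hG (measurable_invBranch hl n)]

/-- Duality: the density `ρ`, fixed by the normalised transfer operator, defines an invariant
measure. -/
theorem IsBranchConformal.setLIntegral_preimage (h : IsBranchConformal hl 1 m)
    {G : Ioc (0 : ℝ) 1 → ℝ≥0∞} (hG : Measurable G)
    (hfix : ∀ x, ∑' n, nullMatrix n (idx hl x) * G (invBranch hl n x) = G x)
    {A : Set (Ioc (0 : ℝ) 1)} (hA : MeasurableSet A) :
    ∫⁻ x in F hl ⁻¹' A, G x ∂m = ∫⁻ x in A, G x ∂m := by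
  have hFA := measurable_F hl hA
  have hterm : ∀ n, ∫⁻ x in W l n ∩ F hl ⁻¹' A, G x ∂m =
      ∫⁻ y in A, nullMatrix n (idx hl y) * G (invBranch hl n y) ∂m := by
    intro n
    have hE := measurableSet_branchImage hl n
    rw [inter_comm, ← setLIntegral_indicator hFA, h.setLIntegral_W n (hG.indicator hFA),
      ← lintegral_const_mul (weight n) (show Measurable fun y =>
        (F hl ⁻¹' A).indicator G (invBranch hl n y) from
        (hG.indicator hFA).comp (measurable_invBranch hl n)),
      ← lintegral_indicator hE, ← lintegral_indicator hA]
    refine lintegral_congr fun y => ?_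
    by_cases hy : n ≤ idx hl y + 1
    · rw [indicator_of_mem (show y ∈ {y | n ≤ idx hl y + 1} from hy)]
      by_cases hyA : y ∈ A
      · rw [indicator_of_mem hyA, indicator_of_mem (by rwa [mem_preimage, F_invBranch hl hy]),
          nullMatrix_eq, if_pos hy]
      · rw [indicator_of_notMem hyA,
          indicator_of_notMem (by rwa [mem_preimage, F_invBranch hl hy]), mul_zero]
    · rw [indicator_of_notMem (show y ∉ {y | n ≤ idx hl y + 1} from hy)]
      by_cases hyA : y ∈ A
      · rw [indicator_of_mem hyA, nullMatrix_eq, if_neg hy, zero_mul]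
      · rw [indicator_of_notMem hyA]
  rw [setLIntegral_eq_tsum_W hl m hFA]
  simp only [hterm]
  rw [← lintegral_tsum]
  · simp only [hfix]
  · intro n
    exact ((measurable_comp_idx hl (nullMatrix n)).mul
      (hG.comp (measurable_invBranch hl n))).aemeasurable

/-- An integrable positive eigenfunction would be, after normalisation, the density of an
invariant probability measure. -/
theorem IsBranchConformal.lintegral_eigenfunction [IsProbabilityMeasure m]
    (h : IsBranchConformal hl 1 m) {t : ℝ} (ht : l ^ t = 1 / 2) {ρ : Ioc (0 : ℝ) 1 → ℝ}
    (hρ : IsPositiveEigenfunction (F hl) (geomPotential l t) (Real.exp (pressure l t)) ρ) :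
    ∫⁻ x, ENNReal.ofReal (ρ x) ∂m = ∞ := by
  obtain ⟨hmeas, hpos, heig⟩ := hρ
  have hG : Measurable fun x => ENNReal.ofReal (ρ x) := hmeas.ennreal_ofReal
  by_contra hne
  set I := ∫⁻ x, ENNReal.ofReal (ρ x) ∂m with hI
  have hI0 : I ≠ 0 := by
    rw [hI, Ne, lintegral_eq_zero_iff hG]
    intro h0
    obtain ⟨x, hx⟩ := h0.exists
    exact absurd hx (by simpa using hpos x)
  refine h.not_exists_invariant ⟨I⁻¹ • m.withDensity fun x => ENNReal.ofReal (ρ x), ⟨?_⟩,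
    ⟨measurable_F hl, ?_⟩, ?_⟩
  · rw [Measure.smul_apply, withDensity_apply _ MeasurableSet.univ, Measure.restrict_univ,
      smul_eq_mul]
    exact ENNReal.inv_mul_cancel hI0 hne
  · refine Measure.ext fun A hA => ?_
    rw [Measure.map_apply (measurable_F hl) hA, Measure.smul_apply, Measure.smul_apply,
      withDensity_apply _ (measurable_F hl hA), withDensity_apply _ hA,
      h.setLIntegral_preimage hG
        (fun x => (transfer_eigenvalue_iff ht x).mp (heig x)) hA]
  · exact (withDensity_absolutelyContinuous m _).smul_left _

end ConformalMarkov

end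

open ConformalMarkov in
theorem mainTheorem12 (l t : ℝ) (hl : l ∈ Set.Ioo (0 : ℝ) 1) (ht : l ^ t = 1 / 2) :
    ∃ p : ℝ,
      -- `p` is the conformal pressure and the Gurevich pressure, with its explicit value
      p = Real.log ((1 - l) ^ t / (1 - l ^ t)) ∧
      p = ConformalMarkov.conformalPressure (ConformalMarkov.F hl)
        (ConformalMarkov.geomPotential l t) ∧
      IsLeast (ConformalMarkov.conformalParameters (ConformalMarkov.F hl)
        (ConformalMarkov.geomPotential l t)) p ∧
      (∀ e : ℕ+, ConformalMarkov.IsGurevichPressure (ConformalMarkov.F hl)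
        (ConformalMarkov.geomPotential l t) (ConformalMarkov.W l e) p) ∧
      -- null recurrence, through partition functions and through measures
      (∀ e : ℕ+, ConformalMarkov.IsNullRecurrent (ConformalMarkov.F hl)
        (ConformalMarkov.geomPotential l t) (ConformalMarkov.W l e)) ∧
      ConformalMarkov.IsMeasureNullRecurrent (ConformalMarkov.F hl)
        (ConformalMarkov.geomPotential l t) p ∧
      -- the first column of the powers of the matrix, and the local partition functions
      (∀ k : ℕ, 1 ≤ k → ∀ i : ℕ+,
        ConformalMarkov.matPow ConformalMarkov.nullMatrix k i 1 =
          if i = 1 then ((2 * k - 1).choose (k - 1) : ℝ≥0∞) / 2 ^ (2 * k - 1)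
          else if (i : ℕ) ≤ k + 1 then
            ((2 * k + 1 - (i : ℕ)).choose (k + 1 - (i : ℕ)) : ℝ≥0∞) / 2 ^ (2 * k)
          else 0) ∧
      (∀ k : ℕ, 1 ≤ k →
        ConformalMarkov.localPartition (ConformalMarkov.F hl)
            (fun x => ConformalMarkov.geomPotential l t x - p) k (ConformalMarkov.W l 1) =
          ConformalMarkov.matPow ConformalMarkov.nullMatrix k 1 1) ∧
      (∃ C : ℝ, 0 < C ∧ ∀ k : ℕ, 1 ≤ k →
        ENNReal.ofReal (C / Real.sqrt k) ≤
          ConformalMarkov.localPartition (ConformalMarkov.F hl)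
            (fun x => ConformalMarkov.geomPotential l t x - p) k (ConformalMarkov.W l 1)) ∧
      -- the conformal measure `m`, and the eigenfunctions `ρ` of the transfer operator
      ∃ m : Measure (Set.Ioc (0 : ℝ) 1),
        IsProbabilityMeasure m ∧
        ConformalMarkov.IsConformal (ConformalMarkov.F hl)
          (fun x => ConformalMarkov.geomPotential l t x - p) m ∧
        (∀ m' : Measure (Set.Ioc (0 : ℝ) 1), IsProbabilityMeasure m' →
          ConformalMarkov.IsConformal (ConformalMarkov.F hl)
            (fun x => ConformalMarkov.geomPotential l t x - p) m' → m' = m) ∧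
        (∃ ρ : Set.Ioc (0 : ℝ) 1 → ℝ,
          ConformalMarkov.IsPositiveEigenfunction (ConformalMarkov.F hl)
            (ConformalMarkov.geomPotential l t) (Real.exp p) ρ ∧
          (∀ i : ℕ+, ∀ x ∈ ConformalMarkov.W l i, ∀ y ∈ ConformalMarkov.W l i, ρ x = ρ y) ∧
          ∀ i : ℕ+, ∫⁻ x in ConformalMarkov.W l i, ENNReal.ofReal (ρ x) ∂m = 1) ∧
        ∀ ρ : Set.Ioc (0 : ℝ) 1 → ℝ,
          ConformalMarkov.IsPositiveEigenfunction (ConformalMarkov.F hl)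
            (ConformalMarkov.geomPotential l t) (Real.exp p) ρ →
          ∫⁻ x, ENNReal.ofReal (ρ x) ∂m = ∞ := by
  have hφ := ofReal_exp_geomPotential_sub hl ht
  have hconf : ∀ m : Measure (Set.Ioc (0 : ℝ) 1),
      IsConformal (F hl) (fun x => geomPotential l t x - pressure l t) m ↔
        IsBranchConformal hl 1 m :=
    isConformal_iff_isBranchConformal hl one_ne_zero ENNReal.one_ne_top
      fun x => by rw [one_mul]; exact hφ x
  have := isProbabilityMeasure_map_code hl
  have hm := isBranchConformal_map_code hl
  have hmin : ∀ q ∈ conformalParameters (F hl) (geomPotential l t), pressure l t ≤ q := by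
    rintro q ⟨m, hprob, hm⟩
    rw [isConformal_iff_isBranchConformal hl (c := ENNReal.ofReal (Real.exp (pressure l t - q)))
      (by simp [Real.exp_pos]) ENNReal.ofReal_ne_top] at hm
    · have := hm.le_one (Real.exp_pos _)
      rw [Real.exp_le_one_iff] at this
      linarith
    · intro x
      rw [← hφ, ← ENNReal.ofReal_mul (Real.exp_pos _).le, ← Real.exp_add]
      congr 2
      ring
  have hleast : IsLeast (conformalParameters (F hl) (geomPotential l t)) (pressure l t) :=
    ⟨⟨_, this, (hconf _).mpr hm⟩, hmin⟩
  refine ⟨pressure l t, rfl, hleast.csInf_eq.symm, hleast, isGurevichPressure_geomPotential hl ht,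
    isNullRecurrent_geomPotential hl ht, ⟨⟨_, this, (hconf _).mpr hm, hm.isConservative⟩, ?_⟩,
    fun k hk i => matPow_nullMatrix_col_cases hk i, fun k hk => localPartition_eq hl hφ 1 hk,
    ⟨1 / 2, by norm_num, fun k hk => ?_⟩, _, this, (hconf _).mpr hm, ?_,
    ⟨_, isPositiveEigenfunction_two_pow hl ht, ?_, fun i => ?_⟩, ?_⟩
  · intro m hprob hm _
    exact ((hconf m).mp hm).not_exists_invariant
  · rw [localPartition_eq hl hφ 1 hk, matPow_one_one]
    exact ENNReal.ofReal_le_ofReal (inv_sqrt_le_centralProb hk)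
  · intro m' hprob hm'
    exact ((hconf m').mp hm').unique hm
  · intro i x hx y hy
    rw [mem_W_iff_idx hl] at hx hy
    rw [hx, hy]
  · rw [← hm.two_pow_mul_measure_W i, ← setLIntegral_const]
    refine setLIntegral_congr_fun (measurableSet_W l i) fun x hx => ?_
    rw [(mem_W_iff_idx hl i x).mp hx, ENNReal.ofReal_pow (by norm_num), ENNReal.ofReal_ofNat]
  · exact fun ρ hρ => hm.lintegral_eigenfunction ht hρ
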